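/- Conventions. For a complex abelian variety $A$, $H^{r}(A,K)=\bigwedge^{r}H^{1}(A,K)$, $H^{p,q}(A)=\bigwedge^{p}H^{1,0}(A)\otimes\bigwedge^{q}H^{0,1}(A)\subset H^{p+q}(A,\mathbb{C})$, and a Hodge class of degree $p$ on $A$ is an element of $H^{2p}(A,\mathbb{Q})$ whose image in $H^{2p}(A,\mathbb{C})$ lies in $H^{p,p}(A)$. A CM-algebra is a finite product of CM-fields, and $A$ is of CM-type if $\mathrm{End}^{0}(A)=\mathrm{End}(A)\otimes\mathbb{Q}$ contains a CM-algebra $E$ such that $H^{1}(A,\mathbb{Q})$ is free of rank $1$ as an $E$-module. Let $F$ be a CM-field and $\nu\colon F\to\mathrm{End}^{0}(B)$ a homomorphism, with $B$ a complex abelian variety, and let $d=\dim_{F}H^{1}(B,\mathbb{Q})$. The pair $(B,\nu)$ is of Weil type if $H^{1,0}(B)$ is a free $F\otimes_{\mathbb{Q}}\mathbb{C}$-module. It is of split Weil type if, in addition, $B$ has a polarization whose Rosati involution stabilizes $\nu(F)$ and acts on it as complex conjugation, and whose Riemann form on $H_{1}(B,\mathbb{Q})$ is $(x,y)\mapsto\mathrm{Tr}_{F/\mathbb{Q}}(f\,\phi(x,y))$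 for some totally imaginary $f\in F^{\times}$ and some $F$-hermitian form $\phi$ on $H_{1}(B,\mathbb{Q})$ that admits a totally isotropic $F$-subspace of dimension $d/2$. The Weil classes on a pair $(B,\nu)$ of Weil type are the elements of $H^{d}(B,\mathbb{Q})$ of the form $\mathrm{Tr}_{F/\mathbb{Q}}\circ\eta$, where $\eta\in\bigwedge_{F}^{d}H^{1}(B,\mathbb{Q})$ is regarded as an $F$-multilinear alternating form $H_{1}(B,\mathbb{Q})^{d}\to F$. Theorem (after André). Let $A$ be a complex abelian variety of CM-type. Then there are a CM-field $F$, Galois over $\mathbb{Q}$, a finite family of complex abelian varieties $A_{\Delta}$ with homomorphisms $\nu_{\Delta}\colon F\to\mathrm{End}^{0}(A_{\Delta})$ such that every $(A_{\Delta},\nu_{\Delta})$ is of split Weil type, and homomorphisms $f_{\Delta}\colon A\to A_{\Delta}$, such that, for every $p\geq 0$, every Hodge class $t$ of degree $p$ on $A$ can be written as a sum $t=\sum_{\Delta}f_{\Delta}^{\ast}(t_{\Delta})$ over some of the $\Delta$ with $\dim_{F}H^{1}(A_{\Delta},\mathbb{Q})=2p$, where $t_{\Delta}$ is a Weil class on $A_{\Delta}$.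 -/

import Mathlib

universe u

open scoped TensorProduct

noncomputable section

/-- A Riemann form for a lattice `Λ` in a complex vector space `V`: an alternating real-bilinear
form on `V`, with integer values on `Λ`, such that `ψ (ix) (iy) = ψ x y` and such that the symmetric
form `(x, y) ↦ ψ (ix) y` is positive definite. -/
structure IsRiemannForm {V : Type*} [NormedAddCommGroup V] [NormedSpace ℂ V]
    (Λ : Submodule ℤ V) (ψ : V →ₗ[ℝ] V →ₗ[ℝ] ℝ) : Prop where
  alternating : ∀ x, ψ x x = 0
  integral : ∀ x ∈ Λ, ∀ y ∈ Λ, ∃ n : ℤ, ψ x y = n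
  map_I : ∀ x y, ψ (Complex.I • x) (Complex.I • y) = ψ x y
  pos : ∀ x, x ≠ 0 → 0 < ψ (Complex.I • x) x

/-- A complex abelian variety, given as a complex torus `V / Λ` (`V` a finite-dimensional complex
vector space, `Λ` a lattice in `V`) that admits a Riemann form. Thus `V` is the Lie algebra of the
abelian variety and `Λ` is its first integral homology group. -/
structure ComplexAbelianVariety where
  V : Type u
  [instNormedAddCommGroup : NormedAddCommGroup V]
  [instNormedSpace : NormedSpace ℂ V]
  [instFiniteDimensional : FiniteDimensional ℂ V]
  lattice : Submodule ℤ V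
  [instDiscreteTopology : DiscreteTopology lattice]
  [instIsZLattice : IsZLattice ℝ lattice]
  polarizable : ∃ ψ : V →ₗ[ℝ] V →ₗ[ℝ] ℝ, IsRiemannForm lattice ψ

namespace ComplexAbelianVariety

attribute [instance] instNormedAddCommGroup instNormedSpace instFiniteDimensional
  instDiscreteTopology instIsZLattice

instance instModuleRat (A : ComplexAbelianVariety) : Module ℚ A.V :=
  Module.compHom A.V (algebraMap ℚ ℂ)

instance instIsScalarTowerRat (A : ComplexAbelianVariety) : IsScalarTower ℚ ℂ A.V :=
  IsScalarTower.rat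

/-! ### Homomorphisms and endomorphisms -/

/-- A homomorphism `V / Λ → V' / Λ'` of abelian varieties: a complex-linear map `V → V'` that maps
`Λ` into `Λ'`. -/
structure Hom (A B : ComplexAbelianVariety) where
  toLinearMap : A.V →ₗ[ℂ] B.V
  map_lattice : ∀ x ∈ A.lattice, toLinearMap x ∈ B.lattice

/-- The endomorphism ring `End(A)`. -/
def endRing (A : ComplexAbelianVariety) : Subring (Module.End ℂ A.V) where
  carrier := {φ | ∀ x ∈ A.lattice, φ x ∈ A.lattice}
  mul_mem' := fun hφ hψ x hx => hφ _ (hψ x hx)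
  one_mem' := fun _ hx => hx
  add_mem' := fun hφ hψ x hx => A.lattice.add_mem (hφ x hx) (hψ x hx)
  zero_mem' := fun _ _ => A.lattice.zero_mem
  neg_mem' := fun hφ x hx => A.lattice.neg_mem (hφ x hx)

/-- The ring `End⁰(A) = End(A) ⊗ ℚ`, realized as the ring of complex-linear maps `V → V` that have
a nonzero integer multiple in `End(A)`. -/
def End0 (A : ComplexAbelianVariety) : Subring (Module.End ℂ A.V) where
  carrier := {φ | ∃ n : ℕ, n ≠ 0 ∧ n • φ ∈ A.endRing}
  mul_mem' := by
    rintro φ ψ ⟨m, hm, hφ⟩ ⟨n, hn, hψ⟩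
    refine ⟨m * n, Nat.mul_ne_zero hm hn, ?_⟩
    have h := A.endRing.mul_mem hφ hψ
    rwa [smul_mul_smul_comm] at h
  one_mem' := ⟨1, one_ne_zero, by rw [one_smul]; exact A.endRing.one_mem⟩
  add_mem' := by
    rintro φ ψ ⟨m, hm, hφ⟩ ⟨n, hn, hψ⟩
    refine ⟨m * n, Nat.mul_ne_zero hm hn, ?_⟩
    have h := A.endRing.add_mem (A.endRing.nsmul_mem hφ n) (A.endRing.nsmul_mem hψ m)
    rwa [smul_smul, smul_smul, mul_comm n m, ← smul_add] at h
  zero_mem' := ⟨1, one_ne_zero, by rw [smul_zero]; exact A.endRing.zero_mem⟩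
  neg_mem' := by
    rintro φ ⟨n, hn, hφ⟩
    refine ⟨n, hn, ?_⟩
    rw [smul_neg]
    exact A.endRing.neg_mem hφ

/-! ### Homology and cohomology -/

/-- The rational homology `H₁(A, ℚ) = Λ ⊗ ℚ`, realized as the rational span of `Λ` in `V`. -/
abbrev Homology (A : ComplexAbelianVariety) : Submodule ℚ A.V :=
  Submodule.span ℚ (A.lattice : Set A.V)

theorem Hom.map_homology {A B : ComplexAbelianVariety} (f : Hom A B) :
    ∀ x ∈ A.Homology, f.toLinearMap.restrictScalars ℚ x ∈ B.Homology := by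
  intro x hx
  have h : A.Homology ≤ B.Homology.comap (f.toLinearMap.restrictScalars ℚ) :=
    Submodule.span_le.mpr fun y hy => Submodule.subset_span (f.map_lattice y hy)
  exact h hx

/-- The map `f_* : H₁(A, ℚ) → H₁(B, ℚ)`. -/
def Hom.homologyMap {A B : ComplexAbelianVariety} (f : Hom A B) :
    A.Homology →ₗ[ℚ] B.Homology :=
  (f.toLinearMap.restrictScalars ℚ).restrict f.map_homology

theorem End0_map_homology (A : ComplexAbelianVariety) (φ : A.End0) :
    ∀ x ∈ A.Homology, (φ : Module.End ℂ A.V).restrictScalars ℚ x ∈ A.Homology := by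
  obtain ⟨φ, n, hn, hφ⟩ := φ
  intro x hx
  have h : A.Homology ≤ A.Homology.comap (φ.restrictScalars ℚ) := by
    refine Submodule.span_le.mpr fun y hy => ?_
    have h1 : (n : ℚ) • φ y ∈ A.Homology := by
      rw [Nat.cast_smul_eq_nsmul]
      exact Submodule.subset_span (hφ y hy)
    exact (Submodule.smul_mem_iff A.Homology (Nat.cast_ne_zero.mpr hn)).mp h1
  exact h hx

/-- The action of an element of `End⁰(A)` on `H₁(A, ℚ)`. -/
def homologyEnd (A : ComplexAbelianVariety) (φ : A.End0) : A.Homology →ₗ[ℚ] A.Homology :=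
  ((φ : Module.End ℂ A.V).restrictScalars ℚ).restrict (A.End0_map_homology φ)

/-- `H¹(A, K) = Hom(H₁(A, ℚ), K)`. -/
abbrev Cohomology1 (A : ComplexAbelianVariety) (K : Type*) [AddCommGroup K] [Module ℚ K] : Type _ :=
  A.Homology →ₗ[ℚ] K

/-- `Hʳ(A, K) = ⋀ʳ H¹(A, K)`, realized as the space of alternating `r`-linear forms on `H₁(A, ℚ)`
with values in `K`. -/
abbrev Cohomology (A : ComplexAbelianVariety) (K : Type*) [AddCommGroup K] [Module ℚ K]
    (r : ℕ) : Type _ :=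
  A.Homology [⋀^Fin r]→ₗ[ℚ] K

/-- The pull-back map `f^* : Hʳ(B, ℚ) → Hʳ(A, ℚ)`. -/
def Hom.pullback {A B : ComplexAbelianVariety} (f : Hom A B) {r : ℕ} (t : B.Cohomology ℚ r) :
    A.Cohomology ℚ r :=
  t.compLinearMap f.homologyMap

/-! ### The Hodge decomposition and Hodge classes -/

/-- `H^{1,0}(A) ⊆ H¹(A, ℂ)`: the forms that are restrictions of complex-linear forms on `V`. -/
def hodge10 (A : ComplexAbelianVariety) : Submodule ℂ (A.Cohomology1 ℂ) where
  carrier := {ω | ∃ l : A.V →ₗ[ℂ] ℂ, ∀ x : A.Homology, ω x = l x}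
  add_mem' := by
    rintro ω η ⟨l, hl⟩ ⟨m, hm⟩
    exact ⟨l + m, fun x => by simp [hl, hm]⟩
  zero_mem' := ⟨0, fun _ => rfl⟩
  smul_mem' := by
    rintro c ω ⟨l, hl⟩
    exact ⟨c • l, fun x => by simp [hl]⟩

/-- `H^{0,1}(A) ⊆ H¹(A, ℂ)`: the complex conjugates of the elements of `H^{1,0}(A)`. -/
def hodge01 (A : ComplexAbelianVariety) : Set (A.Cohomology1 ℂ) :=
  {η | ∃ ω ∈ A.hodge10, ∀ x, η x = starRingEnd ℂ (ω x)}

/-- The exterior product `l₁ ∧ ⋯ ∧ l_r` in `Hʳ(A, ℂ)` of elements of `H¹(A, ℂ)`, that is, the form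
`(x₁, …, x_r) ↦ det (l_j (x_i))`. -/
def wedge (A : ComplexAbelianVariety) {r : ℕ} (l : Fin r → A.Cohomology1 ℂ) :
    A.Cohomology ℂ r where
  toFun v := Matrix.det (Matrix.of fun i j => l j (v i))
  map_update_add' := by
    intro dec v i x y
    obtain rfl : dec = instDecidableEqFin r := Subsingleton.elim _ _
    have h (z) : (fun k j => l j (Function.update v i z k)) =
        Function.update (fun k j => l j (v k)) i (fun j => l j z) := by
      funext k
      rcases eq_or_ne k i with rfl | hk <;> simp [*]
    rw [h, h, h, show (fun j => l j (x + y)) = (fun j => l j x) + fun j => l j y from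
      funext fun j => map_add (l j) x y]
    exact Matrix.detRowAlternating.map_update_add _ i _ _
  map_update_smul' := by
    intro dec v i c x
    obtain rfl : dec = instDecidableEqFin r := Subsingleton.elim _ _
    have h (z) : (fun k j => l j (Function.update v i z k)) =
        Function.update (fun k j => l j (v k)) i (fun j => l j z) := by
      funext k
      rcases eq_or_ne k i with rfl | hk <;> simp [*]
    rw [h, h, show (fun j => l j (c • x)) = (algebraMap ℚ ℂ c) • fun j => l j x from
      funext fun j => (map_smul (l j) c x).trans (Algebra.smul_def _ _), Algebra.smul_def c]
    exact Matrix.detRowAlternating.map_update_smul _ i _ _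
  map_eq_zero_of_eq' v i j h hij :=
    Matrix.det_zero_of_row_eq hij (funext fun k => congrArg (l k) h)

/-- `H^{p,q}(A) = ⋀ᵖ H^{1,0}(A) ⊗ ⋀^q H^{0,1}(A)`, as a subspace of `H^{p+q}(A, ℂ)`. -/
def hodgePiece (A : ComplexAbelianVariety) (p q : ℕ) : Submodule ℂ (A.Cohomology ℂ (p + q)) :=
  Submodule.span ℂ {η | ∃ (l : Fin p → A.Cohomology1 ℂ) (m : Fin q → A.Cohomology1 ℂ),
    (∀ i, l i ∈ A.hodge10) ∧ (∀ j, m j ∈ A.hodge01) ∧ η = A.wedge (Fin.append l m)}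

/-- `t ∈ H^{2p}(A, ℚ)` is a Hodge class (of degree `p`) if its image in `H^{2p}(A, ℂ)` lies in
`H^{p,p}(A)`. -/
def IsHodgeClass (A : ComplexAbelianVariety) {p : ℕ} (t : A.Cohomology ℚ (p + p)) : Prop :=
  (Algebra.linearMap ℚ ℂ).compAlternatingMap t ∈ A.hodgePiece p p

/-! ### Actions of commutative rings on homology and cohomology -/

section Action

variable {A : ComplexAbelianVariety} {E : Type*} [CommRing E] (ν : E →+* A.End0)

/-- `H₁(A, ℚ)` as a module over a ring `E` acting on `A` through `ν : E → End⁰(A)`. -/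
@[reducible] def homologyModule : Module E A.Homology where
  smul a x := A.homologyEnd (ν a) x
  one_smul x := Subtype.ext <| show ((ν 1 : A.End0) : Module.End ℂ A.V) x = x by
    rw [map_one]; rfl
  mul_smul a b x := Subtype.ext <|
    show ((ν (a * b) : A.End0) : Module.End ℂ A.V) x = (ν a).1 ((ν b).1 x) by
    rw [map_mul]; rfl
  smul_zero a := map_zero _
  smul_add a x y := map_add _ x y
  add_smul a b x := Subtype.ext <|
    show ((ν (a + b) : A.End0) : Module.End ℂ A.V) x = (ν a).1 x + (ν b).1 x by
    rw [map_add]; rfl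
  zero_smul x := Subtype.ext <| show ((ν 0 : A.End0) : Module.End ℂ A.V) x = 0 by
    rw [map_zero]; rfl

/-- `H¹(A, K)` as a module over a ring `E` acting on `A` through `ν : E → End⁰(A)`: an element `a`
acts as the transpose of its action on `H₁(A, ℚ)`. -/
@[reducible] def cohomology1Module (K : Type*) [AddCommGroup K] [Module ℚ K] :
    Module E (A.Cohomology1 K) :=
  letI := homologyModule ν
  { smul := fun a l => l ∘ₗ A.homologyEnd (ν a)
    one_smul := fun l => LinearMap.ext fun x => congrArg l (one_smul E x)
    mul_smul := fun a b l => LinearMap.ext fun x => congrArg l <|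
      show (a * b) • x = b • a • x by rw [mul_comm, mul_smul]
    smul_zero := fun _ => rfl
    smul_add := fun _ _ _ => rfl
    add_smul := fun a b l => LinearMap.ext fun x =>
      (congrArg l (add_smul a b x)).trans (map_add l _ _)
    zero_smul := fun l => LinearMap.ext fun x =>
      (congrArg l (zero_smul E x)).trans (map_zero l) }

theorem comp_homologyEnd_mem_hodge10 (φ : A.End0) {ω : A.Cohomology1 ℂ} (hω : ω ∈ A.hodge10) :
    ω ∘ₗ A.homologyEnd φ ∈ A.hodge10 := by
  obtain ⟨l, hl⟩ := hω
  exact ⟨l ∘ₗ φ.1, fun x => hl _⟩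

/-- `H^{1,0}(A)` as an `E`-submodule of `H¹(A, ℂ)`. -/
@[reducible] def hodge10Module : Module E A.hodge10 :=
  letI := cohomology1Module ν ℂ
  { smul := fun a ω => ⟨a • ω.1, comp_homologyEnd_mem_hodge10 (ν a) ω.2⟩
    one_smul := fun ω => Subtype.ext (one_smul E ω.1)
    mul_smul := fun a b ω => Subtype.ext (mul_smul a b ω.1)
    smul_zero := fun a => Subtype.ext (smul_zero a)
    smul_add := fun a ω η => Subtype.ext (smul_add a ω.1 η.1)
    add_smul := fun a b ω => Subtype.ext (add_smul a b ω.1)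
    zero_smul := fun ω => Subtype.ext (zero_smul E ω.1) }

theorem hodge10_smulCommClass :
    letI := hodge10Module ν
    SMulCommClass E ℂ A.hodge10 :=
  letI := hodge10Module ν
  ⟨fun _ _ _ => rfl⟩

/-- `H^{1,0}(A)` as a module over `E ⊗ ℂ`, with `a ⊗ z` acting as `ω ↦ a • z • ω`. -/
@[reducible] def hodge10TensorModule [Algebra ℚ E] : Module (E ⊗[ℚ] ℂ) A.hodge10 :=
  letI := hodge10Module ν
  haveI := hodge10_smulCommClass ν
  TensorProduct.Algebra.module

end Action

/-! ### Abelian varieties of CM-type -/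

/-- A CM-algebra is a ring isomorphic to a finite product of CM-fields (of finite degree). -/
def IsCMAlgebra (E : Type*) [CommRing E] : Prop :=
  ∃ (n : ℕ) (K : Fin n → Type) (_ : ∀ i, Field (K i)) (_ : ∀ i, NumberField (K i)),
    (∀ i, NumberField.IsCMField (K i)) ∧ Nonempty (E ≃+* ∀ i, K i)

/-- `A` is of CM-type if `End⁰(A)` contains a CM-algebra `E` such that `H¹(A, ℚ)` is free of
rank `1` as an `E`-module. -/
def IsCMType (A : ComplexAbelianVariety) : Prop :=
  ∃ (E : Type) (_ : CommRing E) (ν : E →+* A.End0),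
    IsCMAlgebra E ∧ Function.Injective ν ∧
    letI := cohomology1Module ν ℚ
    Module.Free E (A.Cohomology1 ℚ) ∧ Module.finrank E (A.Cohomology1 ℚ) = 1

/-! ### Weil type, split Weil type and Weil classes -/

section Weil

variable {A : ComplexAbelianVariety} {E : Type*} [Field E]

/-- `(A, ν)` is of Weil type if `H^{1,0}(A)` is a free `E ⊗ ℂ`-module. -/
def IsWeilType [NumberField E] (ν : E →+* A.End0) : Prop :=
  letI := hodge10TensorModule ν
  Module.Free (E ⊗[ℚ] ℂ) A.hodge10

/-- The number `d = dim_E H¹(A, ℚ)`. -/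
def weilDegree (ν : E →+* A.End0) : ℕ :=
  letI := cohomology1Module ν ℚ
  Module.finrank E (A.Cohomology1 ℚ)

/-- `t ∈ Hʳ(A, ℚ)` is a Weil class on `(A, ν)` if `r = d = dim_E H¹(A, ℚ)` and `t` lies in the
subspace `⋀_E^d H¹(A, ℚ)` of `H^d(A, ℚ)`. Here the one-dimensional `E`-vector space
`⋀_E^d H¹(A, ℚ)` is the space of `E`-multilinear alternating forms `η : H₁(A, ℚ)^d → E`, and it is
embedded in `H^d(A, ℚ)` by `η ↦ Tr_{E/ℚ} ∘ η`. -/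
def IsWeilClass (ν : E →+* A.End0) [NumberField E] {r : ℕ} (t : A.Cohomology ℚ r) : Prop :=
  letI := homologyModule ν
  weilDegree ν = r ∧
    ∃ η : A.Homology [⋀^Fin r]→ₗ[E] E, ∀ v, t v = Algebra.trace ℚ E (η v)

variable [NumberField E] [NumberField.IsCMField E]

/-- Complex conjugation on the CM-field `E`. -/
def cmConj (E : Type*) [Field E] [NumberField E] [NumberField.IsCMField E] : E →+* E :=
  (NumberField.IsCMField.complexConj E : E →+* E)

/-- A polarization of `(A, ν)`, given by its Riemann form: the Rosati involution stabilizes `ν(E)`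
and acts on it as complex conjugation. -/
def IsPolarization (ν : E →+* A.End0) (ψ : A.V →ₗ[ℝ] A.V →ₗ[ℝ] ℝ) : Prop :=
  IsRiemannForm A.lattice ψ ∧ ∀ (a : E) (x y : A.V), ψ ((ν a).1 x) y = ψ x ((ν (cmConj E a)).1 y)

/-- `(A, ν)` is of split Weil type if it is of Weil type and there is a polarization of `(A, ν)`
whose Riemann form on `H₁(A, ℚ)` is `(x, y) ↦ Tr_{E/ℚ} (f φ(x, y))`, with `f` a totally imaginary
element of `E` and `φ` an `E`-hermitian form on `H₁(A, ℚ)` that is split: there is a totally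
isotropic `E`-subspace of dimension `d / 2`. -/
def IsSplitWeilType (ν : E →+* A.End0) : Prop :=
  letI := homologyModule ν
  IsWeilType ν ∧
    ∃ (ψ : A.V →ₗ[ℝ] A.V →ₗ[ℝ] ℝ) (f : E)
      (φ : A.Homology →ₗ[E] A.Homology →ₛₗ[cmConj E] E) (W : Submodule E A.Homology),
      IsPolarization ν ψ ∧
      f ≠ 0 ∧ cmConj E f = -f ∧
      (∀ x y, φ y x = cmConj E (φ x y)) ∧
      (∀ x y : A.Homology, ψ x y = ((Algebra.trace ℚ E (f * φ x y) : ℚ) : ℝ)) ∧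
      (∀ x ∈ W, ∀ y ∈ W, φ x y = 0) ∧
      2 * Module.finrank E W = weilDegree ν

end Weil

end ComplexAbelianVariety

end

/-! Let `E` be the CM-algebra acting on `A`, and let `F` be a Galois CM-field containing all
conjugates of the factors of `E`. Over `F`, `H¹(A, F)` splits into lines on which `E` acts through
the homomorphisms `E → F`. An eigenform is of pure type, (1,0) or (0,1), under every complex
embedding τ of `F`, and replacing τ by its conjugate exchanges the two types
(`mem_hodge_of_eigenvector`, `IsCMType.exists_hodgeFrame`).

Expand a Hodge class `t` of degree `p` in products of `2p` eigenforms. Since `t` is rational,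
applying τ to its coefficients gives the coefficients of the same complex class in the frame at τ.
Hence a tuple with nonzero coefficient has exactly `p` members of type (1,0) at τ, and this for
every τ (`HodgeFrame.card_holomorphicIndices`).

Such a balanced tuple prescribes a complex structure on `F^{2p} ⊗ ℝ`: at τ, the holomorphic
coordinates are those whose eigenform is (1,0) at τ. The quotient by the lattice `(𝓞 F)^{2p}` is the
target abelian variety, and the eigenforms are the components of a homomorphism from `A` to it. Its
Weil classes are the traces of multiples of the determinant, so they pull back to traces of
multiples of determinants of eigenforms (`HodgeFrame.exists_hom_isWeilClass`). Antisymmetrizing the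
expansion of `t` and taking the trace from `F` to `ℚ` writes `t` as a sum of exactly such terms
(`HodgeFrame.eq_sum_trace`).

It remains to see that the target is of split Weil type. Balance makes `H^{1,0}` free over `F ⊗ ℂ`.
A polarization comes from a diagonal hermitian form with coefficients `c j`, where positivity
dictates the sign of every `c j` at every place, with `p` positive signs at each. The form must also
be split. For this one starts from `p` copies of 1 and `p` copies of -1 and changes the
diagonalization of this one hermitian space: a change of orthogonal basis in a coordinate plane,
with a parameter large at one place and small at the others, exchanges two signs at that place only
(`IsSplitDiagonal.exists_swap`). Every balanced sign pattern is reached in this way. -/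

noncomputable section

namespace ComplexAbelianVariety

open NumberField

/-! ### Split hermitian forms with prescribed signs -/

section Positivity

variable {F : Type*} [Field F]

/-- The coefficients of a diagonal hermitian form that are positive at the place `w`. -/
def positiveAt {ι : Type*} [Fintype ι] (c : ι → F) (w : InfinitePlace F) : Finset ι :=
  letI := Classical.decPred fun j => 0 < (w.embedding (c j)).re
  Finset.univ.filter fun j => 0 < (w.embedding (c j)).re

theorem mem_positiveAt {ι : Type*} [Fintype ι] {c : ι → F} {w : InfinitePlace F} {j : ι} :
    j ∈ positiveAt c w ↔ 0 < (w.embedding (c j)).re := by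
  simp [positiveAt]

end Positivity

section Hermitian

variable {F : Type*} [Field F] [NumberField F] [IsCMField F]

theorem map_cmConj (φ : F →+* ℂ) (x : F) : φ (cmConj F x) = starRingEnd ℂ (φ x) :=
  IsCMField.complexEmbedding_complexConj F φ x

theorem cmConj_cmConj (x : F) : cmConj F (cmConj F x) = x :=
  IsCMField.complexConj_apply_apply F x

theorem map_eq_re_of_cmConj_eq {x : F} (hx : cmConj F x = x) (φ : F →+* ℂ) :
    φ x = ((φ x).re : ℂ) := by
  have h := map_cmConj φ x
  rw [hx] at h
  exact (Complex.conj_eq_iff_re.mp h.symm).symm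

theorem re_ne_zero_of_cmConj_eq {x : F} (hx : cmConj F x = x) (h0 : x ≠ 0) (φ : F →+* ℂ) :
    (φ x).re ≠ 0 := by
  intro h
  have h1 := map_eq_re_of_cmConj_eq hx φ
  rw [h, Complex.ofReal_zero] at h1
  exact h0 ((map_eq_zero φ).mp h1)

theorem map_mul_cmConj_self (w : InfinitePlace F) (y : F) :
    w.embedding (y * cmConj F y) = ((w y ^ 2 : ℝ) : ℂ) := by
  rw [map_mul, map_cmConj, Complex.mul_conj, Complex.normSq_eq_norm_sq,
    InfinitePlace.norm_embedding_eq]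

/-- The diagonal hermitian form with coefficients `c` is nondegenerate and has a totally isotropic
subspace of half the dimension. -/
def IsSplitDiagonal {ι : Type*} [Fintype ι] (c : ι → F) : Prop :=
  (∀ j, c j ≠ 0) ∧ (∀ j, cmConj F (c j) = c j) ∧
    ∃ W : Submodule F (ι → F), 2 * Module.finrank F W = Fintype.card ι ∧
      ∀ x ∈ W, ∀ y ∈ W, ∑ j, c j * x j * cmConj F (y j) = 0

/-- An element that is large at one given place and small at all the others. -/
theorem exists_large_small {F : Type*} [Field F] [NumberField F] (v : InfinitePlace F)
    (M : InfinitePlace F → ℝ) (hM : ∀ w, 0 < M w) :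
    ∃ y : F, M v < v y ^ 2 ∧ ∀ w ≠ v, w y ^ 2 < M w := by
  -- Weak approximation supplies an element larger than 1 at `v` and smaller than 1 elsewhere; a
  -- high power of it meets all the bounds.
  obtain ⟨x, hx, hx'⟩ := AbsoluteValue.exists_one_lt_lt_one_pi_of_not_isEquiv
    (v := fun w : InfinitePlace F => w.1) (fun w => w.isNontrivial)
    (fun _ _ h => (InfinitePlace.eq_iff_isEquiv (K := F)).not.mp h) v
  have h1 : ∀ᶠ n : ℕ in Filter.atTop, M v < v (x ^ n) ^ 2 := by
    have : Filter.Tendsto (fun n : ℕ => (v x ^ 2) ^ n) Filter.atTop Filter.atTop :=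
      tendsto_pow_atTop_atTop_of_one_lt (one_lt_pow₀ hx two_ne_zero)
    filter_upwards [this.eventually_gt_atTop (M v)] with n hn
    rwa [map_pow, ← pow_mul, mul_comm, pow_mul]
  have h2 : ∀ᶠ n : ℕ in Filter.atTop, ∀ w : InfinitePlace F, w ≠ v → w (x ^ n) ^ 2 < M w := by
    refine Filter.eventually_all.mpr fun w => ?_
    by_cases hw : w = v
    · exact Filter.Eventually.of_forall fun n h => absurd hw h
    · have : Filter.Tendsto (fun n : ℕ => (w x ^ 2) ^ n) Filter.atTop (nhds 0) :=
        tendsto_pow_atTop_nhds_zero_of_lt_one (by positivity)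
          (pow_lt_one₀ (apply_nonneg w x) (hx' w hw) two_ne_zero)
      filter_upwards [this.eventually_lt_const (hM w)] with n hn _
      rwa [map_pow, ← pow_mul, mul_comm, pow_mul]
  obtain ⟨n, hn1, hn2⟩ := (h1.and h2).exists
  exact ⟨x ^ n, hn1, hn2⟩

theorem Fintype.sum_eq_add_add_sum_sdiff {ι M : Type*} [Fintype ι] [DecidableEq ι]
    [AddCommMonoid M] {i j : ι} (hij : i ≠ j) (f : ι → M) :
    ∑ k, f k = f i + f j + ∑ k ∈ Finset.univ \ {i, j}, f k := by
  rw [← Finset.sum_pair hij, add_comm, Finset.sum_sdiff (Finset.subset_univ _)]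

section

variable {ι : Type*} [Fintype ι] [DecidableEq ι]

/-- Replacing `⟨a, b⟩` by the isometric form `⟨a + b y ȳ, a b (a + b y ȳ)⟩`. -/
def rotateDiagonal (c : ι → F) (i j : ι) (y : F) : ι → F :=
  Function.update (Function.update c i (c i + c j * (y * cmConj F y))) j
    (c i * c j * (c i + c j * (y * cmConj F y)))

/-- The new coefficients are the norms of another orthogonal basis of the plane spanned by `e_i` and
`e_j`, namely `e_i + y e_j` and `-c_j ȳ e_i + c_i e_j`. The hermitian space is unchanged up to
isometry, so an isotropic subspace can be carried along. -/
theorem IsSplitDiagonal.rotate {c : ι → F} (hc : IsSplitDiagonal c) {i j : ι} (hij : i ≠ j) {y : F}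
    (hy : c i + c j * (y * cmConj F y) ≠ 0) : IsSplitDiagonal (rotateDiagonal c i j y) := by
  obtain ⟨h0, hre, W, hW, hiso⟩ := hc
  have hdi : rotateDiagonal c i j y i = c i + c j * (y * cmConj F y) := by
    simp [rotateDiagonal, hij]
  have hdj : rotateDiagonal c i j y j = c i * c j * (c i + c j * (y * cmConj F y)) := by
    simp [rotateDiagonal]
  have hdk : ∀ k, k ≠ i → k ≠ j → rotateDiagonal c i j y k = c k := by
    intro k hi hj
    simp [rotateDiagonal, hi, hj]
  -- The change of basis, an isometry from the new form to the old one. On the `(i, j)` plane its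
  -- determinant is `c i + c j * (y * cmConj F y)`, nonzero by hypothesis.
  let h : (ι → F) →ₗ[F] (ι → F) :=
    { toFun := fun x k => if k = i then x i - c j * cmConj F y * x j
        else if k = j then y * x i + c i * x j else x k
      map_add' := fun x z => by
        funext k
        simp only [Pi.add_apply]
        split_ifs <;> ring
      map_smul' := fun a x => by
        funext k
        simp only [Pi.smul_apply, smul_eq_mul, RingHom.id_apply]
        split_ifs <;> ring }
  have hi (x) : h x i = x i - c j * cmConj F y * x j := by simp [h]
  have hj (x) : h x j = y * x i + c i * x j := by simp [h, hij.symm]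
  have hk (x k) (h1 : k ≠ i) (h2 : k ≠ j) : h x k = x k := by simp [h, h1, h2]
  have hform (x z) : ∑ k, c k * h x k * cmConj F (h z k) =
      ∑ k, rotateDiagonal c i j y k * x k * cmConj F (z k) := by
    rw [Fintype.sum_eq_add_add_sum_sdiff hij, Fintype.sum_eq_add_add_sum_sdiff hij]
    congr 1
    · rw [hi, hj, hi, hj, hdi, hdj]
      simp only [map_add, map_sub, map_mul, cmConj_cmConj, hre]
      ring
    · refine Finset.sum_congr rfl fun k hmem => ?_
      simp only [Finset.mem_sdiff, Finset.mem_univ, true_and, Finset.mem_insert,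
        Finset.mem_singleton, not_or] at hmem
      rw [hk x k hmem.1 hmem.2, hk z k hmem.1 hmem.2, hdk k hmem.1 hmem.2]
  have hinj : Function.Injective h := by
    refine (injective_iff_map_eq_zero h).mpr fun x hx => ?_
    have e1 : x i - c j * cmConj F y * x j = 0 := by rw [← hi, hx]; rfl
    have e2 : y * x i + c i * x j = 0 := by rw [← hj, hx]; rfl
    have e3 : (c i + c j * (y * cmConj F y)) * x j = 0 := by linear_combination e2 - y * e1
    have xj : x j = 0 := (mul_eq_zero.mp e3).resolve_left hy
    have xi : x i = 0 := by rw [xj] at e1; simpa using e1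
    funext k
    by_cases h1 : k = i
    · rw [h1]; exact xi
    by_cases h2 : k = j
    · rw [h2]; exact xj
    rw [← hk x k h1 h2, hx]
  refine ⟨fun k => ?_, fun k => ?_, W.comap h, ?_, fun x hx z hz => ?_⟩
  · by_cases h2 : k = j
    · rw [h2, hdj]; exact mul_ne_zero (mul_ne_zero (h0 i) (h0 j)) hy
    by_cases h1 : k = i
    · rw [h1, hdi]; exact hy
    rw [hdk k h1 h2]; exact h0 k
  · by_cases h2 : k = j
    · rw [h2, hdj]
      simp only [map_add, map_mul, cmConj_cmConj, hre]
      ring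
    by_cases h1 : k = i
    · rw [h1, hdi]
      simp only [map_add, map_mul, cmConj_cmConj, hre]
      ring
    rw [hdk k h1 h2]; exact hre k
  · rw [← hW]
    congr 1
    let e := LinearEquiv.ofInjectiveEndo h hinj
    have : W.comap h = W.map (e.symm : (ι → F) →ₗ[F] (ι → F)) := by
      rw [Submodule.map_equiv_eq_comap_symm]
      rfl
    rw [this]
    exact LinearEquiv.finrank_map_eq e.symm W
  · rw [← hform]
    exact hiso _ hx _ hz

/-- At `v` the parameter is so large that `a + b y ȳ` takes the sign of `b`, so `a b (a + b y ȳ)`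
takes the sign of `a`: the signs are exchanged. At any other place it is so small that `a + b y ȳ`
keeps the sign of `a`, and the second coefficient keeps the sign of `b`. -/
theorem IsSplitDiagonal.exists_swap {c : ι → F} (hc : IsSplitDiagonal c) {i j : ι}
    {v : InfinitePlace F} (hi : i ∈ positiveAt c v) (hj : j ∉ positiveAt c v) :
    ∃ c' : ι → F, IsSplitDiagonal c' ∧ (∀ w ≠ v, positiveAt c' w = positiveAt c w) ∧
      positiveAt c' v = insert j ((positiveAt c v).erase i) := by
  have hij : i ≠ j := fun h => hj (h ▸ hi)
  have hne (w : InfinitePlace F) (k : ι) : (w.embedding (c k)).re ≠ 0 :=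
    re_ne_zero_of_cmConj_eq (hc.2.1 k) (hc.1 k) _
  -- The ratio of the absolute values of the two coefficients is the value of `|y|²` at which the
  -- two terms of `c i + c j y ȳ` have equal size.
  obtain ⟨y, hy1, hy2⟩ := exists_large_small v
    (fun w => |(w.embedding (c i)).re| / |(w.embedding (c j)).re|)
    (fun w => div_pos (abs_pos.mpr (hne w i)) (abs_pos.mpr (hne w j)))
  have hre (w : InfinitePlace F) : (w.embedding (c i + c j * (y * cmConj F y))).re =
      (w.embedding (c i)).re + (w.embedding (c j)).re * w y ^ 2 := by
    rw [map_add, map_mul, map_mul_cmConj_self, map_eq_re_of_cmConj_eq (hc.2.1 j) w.embedding,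
      ← Complex.ofReal_mul, Complex.add_re, Complex.ofReal_re, Complex.ofReal_re]
  have hre' (w : InfinitePlace F) :
      (w.embedding (c i * c j * (c i + c j * (y * cmConj F y)))).re =
      (w.embedding (c i)).re * (w.embedding (c j)).re *
        ((w.embedding (c i)).re + (w.embedding (c j)).re * w y ^ 2) := by
    rw [map_mul, map_mul, map_eq_re_of_cmConj_eq (hc.2.1 j) w.embedding,
      map_eq_re_of_cmConj_eq (hc.2.1 i) w.embedding, ← Complex.ofReal_mul, Complex.re_ofReal_mul,
      hre]
    simp
  rw [mem_positiveAt] at hi hj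
  have hj' : (v.embedding (c j)).re < 0 := lt_of_le_of_ne (not_lt.mp hj) (hne v j)
  have hv : (v.embedding (c i)).re + (v.embedding (c j)).re * v y ^ 2 < 0 := by
    rw [div_lt_iff₀ (abs_pos.mpr (hne v j)), abs_of_pos hi, abs_of_neg hj'] at hy1
    linarith
  have hw (w) (h : w ≠ v) : |(w.embedding (c j)).re * w y ^ 2| < |(w.embedding (c i)).re| := by
    have := hy2 w h
    rw [lt_div_iff₀ (abs_pos.mpr (hne w j))] at this
    rwa [abs_mul, abs_of_nonneg (sq_nonneg (w y)), mul_comm]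
  have hdi : rotateDiagonal c i j y i = c i + c j * (y * cmConj F y) := by
    simp [rotateDiagonal, hij]
  have hdj : rotateDiagonal c i j y j = c i * c j * (c i + c j * (y * cmConj F y)) := by
    simp [rotateDiagonal]
  have hdk : ∀ k, k ≠ i → k ≠ j → rotateDiagonal c i j y k = c k := by
    intro k hi hj
    simp [rotateDiagonal, hi, hj]
  refine ⟨rotateDiagonal c i j y, hc.rotate hij ?_, fun w h => ?_, ?_⟩
  · intro h
    have := hre v
    rw [h, map_zero, Complex.zero_re] at this
    linarith
  · ext k
    rw [mem_positiveAt, mem_positiveAt]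
    have := hw w h
    have hwi : 0 < (w.embedding (c i)).re + (w.embedding (c j)).re * w y ^ 2 ↔
        0 < (w.embedding (c i)).re := by
      constructor
      · intro h1
        by_contra h2
        rw [abs_of_nonpos (not_lt.mp h2)] at this
        linarith [le_abs_self ((w.embedding (c j)).re * w y ^ 2)]
      · intro h2
        rw [abs_of_pos h2] at this
        linarith [neg_abs_le ((w.embedding (c j)).re * w y ^ 2)]
    have hwi' : 0 < (w.embedding (c i)).re *
        ((w.embedding (c i)).re + (w.embedding (c j)).re * w y ^ 2) := by
      rcases (hne w i).lt_or_gt with h2 | h2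
      · rw [abs_of_neg h2] at this
        exact mul_pos_of_neg_of_neg h2
          (by linarith [le_abs_self ((w.embedding (c j)).re * w y ^ 2)])
      · exact mul_pos h2 (hwi.mpr h2)
    by_cases h2 : k = j
    · rw [h2, hdj, hre', mul_right_comm, mul_pos_iff_of_pos_left hwi']
    by_cases h1 : k = i
    · rw [h1, hdi, hre, hwi]
    rw [hdk k h1 h2]
  · ext k
    rw [mem_positiveAt, Finset.mem_insert, Finset.mem_erase, mem_positiveAt]
    by_cases h2 : k = j
    · subst h2
      rw [hdj, hre']
      simp only [true_or, iff_true]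
      exact mul_pos_of_neg_of_neg (mul_neg_of_pos_of_neg hi hj') hv
    by_cases h1 : k = i
    · subst h1
      rw [hdi, hre]
      simp only [h2, ne_eq, not_true_eq_false, false_and, or_false, iff_false, not_lt]
      exact hv.le
    rw [hdk k h1 h2]
    simp [h1, h2]

/-- Split diagonal hermitian forms realize every signature pattern that is balanced at each
place. -/
theorem exists_isSplitDiagonal_of_isSplitDiagonal {p : ℕ} (T : InfinitePlace F → Finset ι)
    (hT : ∀ w, (T w).card = p) (m : ℕ) : ∀ c : ι → F, IsSplitDiagonal c →
    (∀ w, (positiveAt c w).card = p) → ∑ w, (positiveAt c w \ T w).card = m →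
    ∃ c' : ι → F, IsSplitDiagonal c' ∧ ∀ w, positiveAt c' w = T w := by
  classical
  induction m with
  | zero =>
    intro c hc hp h
    refine ⟨c, hc, fun w => ?_⟩
    have := (Finset.sum_eq_zero_iff.mp h) w (Finset.mem_univ w)
    rw [Finset.card_eq_zero, Finset.sdiff_eq_empty_iff_subset] at this
    exact Finset.eq_of_subset_of_card_le this (by rw [hp, hT])
  | succ m ih =>
    intro c hc hp h
    obtain ⟨v, -, hv⟩ : ∃ v ∈ Finset.univ, (positiveAt c v \ T v).card ≠ 0 :=
      Finset.exists_ne_zero_of_sum_ne_zero (by rw [h]; exact Nat.succ_ne_zero m)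
    have hv' : (T v \ positiveAt c v).card ≠ 0 := by
      rwa [Finset.card_sdiff_comm (by rw [hp, hT])]
    obtain ⟨i, hi⟩ := Finset.card_ne_zero.mp hv
    obtain ⟨j, hj⟩ := Finset.card_ne_zero.mp hv'
    rw [Finset.mem_sdiff] at hi hj
    obtain ⟨c', hc', h1, h2⟩ := hc.exists_swap hi.1 hj.2
    refine ih c' hc' (fun w => ?_) ?_
    · by_cases hw : w = v
      · rw [hw, h2, Finset.card_insert_of_notMem (fun h => hj.2 (Finset.mem_of_mem_erase h)),
          Finset.card_erase_add_one hi.1, hp]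
      · rw [h1 w hw, hp]
    · have h3 : positiveAt c' v \ T v = (positiveAt c v \ T v).erase i := by
        rw [h2, Finset.insert_sdiff_of_mem _ hj.1, Finset.erase_sdiff_comm]
      have h4 : (positiveAt c' v \ T v).card + 1 = (positiveAt c v \ T v).card := by
        rw [h3, Finset.card_erase_add_one (Finset.mem_sdiff.mpr hi)]
      rw [← Finset.add_sum_erase _ _ (Finset.mem_univ v)] at h ⊢
      have h5 : ∑ w ∈ Finset.univ.erase v, (positiveAt c' w \ T w).card =
          ∑ w ∈ Finset.univ.erase v, (positiveAt c w \ T w).card :=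
        Finset.sum_congr rfl fun w hw => by rw [h1 w (Finset.ne_of_mem_erase hw)]
      omega

end

theorem exists_isSplitDiagonal {p : ℕ} (T : InfinitePlace F → Finset (Fin (p + p)))
    (hT : ∀ w, (T w).card = p) :
    ∃ c : Fin (p + p) → F, IsSplitDiagonal c ∧ ∀ w, positiveAt c w = T w := by
  let e : Fin p ⊕ Fin p ≃ Fin (p + p) := finSumFinEquiv
  -- The starting point is the hyperbolic form, for which the diagonal copy of `F^p` in `F^p × F^p`
  -- is isotropic.
  let c : Fin (p + p) → F := fun j => Sum.elim (fun _ => 1) (fun _ => -1) (e.symm j)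
  let D : (Fin p → F) →ₗ[F] (Fin (p + p) → F) :=
    { toFun := fun x j => Sum.elim x x (e.symm j)
      map_add' := fun x y => by
        funext j
        rcases h : e.symm j with k | k <;> simp [h]
      map_smul' := fun a x => by
        funext j
        rcases h : e.symm j with k | k <;> simp [h] }
  refine exists_isSplitDiagonal_of_isSplitDiagonal T hT _ c
    ⟨fun j => ?_, fun j => ?_, LinearMap.range D, ?_, ?_⟩ (fun w => ?_) rfl
  · rcases h : e.symm j with k | k <;> simp [c, h]
  · rcases h : e.symm j with k | k <;> simp [c, h]
  · rw [LinearMap.finrank_range_of_inj, Module.finrank_fin_fun, Fintype.card_fin, two_mul]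
    intro x y hxy
    funext k
    simpa [D] using congrFun hxy (e (Sum.inl k))
  · rintro _ ⟨x, rfl⟩ _ ⟨y, rfl⟩
    rw [← e.sum_comp, Fintype.sum_sum_type]
    simp [c, D]
  · have : positiveAt c w = Finset.univ.map
        (Function.Embedding.inl.trans e.toEmbedding : Fin p ↪ Fin (p + p)) := by
      ext j
      rw [mem_positiveAt]
      obtain ⟨k | k, rfl⟩ := e.surjective j <;> simp [c]
    rw [this, Finset.card_map, Finset.card_univ, Fintype.card_fin]

end Hermitian

end ComplexAbelianVariety

end

/-! ### Combinatorial CM-types and the coefficients of a polarization -/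

noncomputable section

namespace ComplexAbelianVariety

open NumberField

section WeilTypeConstruction

variable {F : Type} [Field F] {p : ℕ}

/-- A choice, for each complex embedding of `F`, of half of the `2p` coordinates, together with a
numbering of it, such that conjugate embeddings give complementary halves. -/
structure WeilCMType (F : Type) [Field F] (p : ℕ) where
  enum : (F →+* ℂ) → Fin p → Fin (p + p)
  injective : ∀ τ, Function.Injective (enum τ)
  mem_range_conjugate : ∀ τ j, j ∈ Set.range (enum (ComplexEmbedding.conjugate τ)) ↔
    j ∉ Set.range (enum τ)

theorem WeilCMType.exists_mem_range (D : WeilCMType F p) (τ : F →+* ℂ) (j : Fin (p + p)) :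
    (∃ k, D.enum τ k = j) ∨ ∃ k, D.enum (ComplexEmbedding.conjugate τ) k = j := by
  by_cases h : j ∈ Set.range (D.enum τ)
  · exact Or.inl h
  · exact Or.inr ((D.mem_range_conjugate τ j).mpr h)

variable [NumberField F] [IsCMField F]

theorem exists_cmConj_eq_neg (F : Type) [Field F] [NumberField F] [IsCMField F] :
    ∃ f : F, f ≠ 0 ∧ cmConj F f = -f := by
  obtain ⟨x, hx⟩ : ∃ x : F, cmConj F x ≠ x := by
    by_contra! h
    exact IsCMField.complexConj_ne_one F (AlgEquiv.ext h)
  exact ⟨x - cmConj F x, sub_ne_zero.mpr hx.symm, by rw [map_sub, cmConj_cmConj]; ring⟩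

/-- For a fixed purely imaginary `f`, the required inequality prescribes the sign of every `c j` at
every place. The conditions at τ and at its conjugate agree, because `f * c j` is purely imaginary
and the two index sets are complementary. So `exists_isSplitDiagonal` applies. -/
theorem WeilCMType.exists_coefficients (D : WeilCMType F p) :
    ∃ (f : F) (c : Fin (p + p) → F), f ≠ 0 ∧ cmConj F f = -f ∧ IsSplitDiagonal c ∧
      (∀ j, IsIntegral ℤ (f * c j)) ∧ ∀ (τ : F →+* ℂ) k, (τ (f * c (D.enum τ k))).im < 0 := by
  classical
  obtain ⟨f, hf0, hf⟩ := exists_cmConj_eq_neg F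
  have hfre (τ : F →+* ℂ) : (τ f).re = 0 := by
    have h := map_cmConj τ f
    rw [hf, map_neg] at h
    have := congrArg Complex.re h
    rw [Complex.neg_re, Complex.conj_re] at this
    linarith
  have hfim (τ : F →+* ℂ) : (τ f).im ≠ 0 := fun h =>
    hf0 ((map_eq_zero τ).mp (Complex.ext (hfre τ) h))
  obtain ⟨c, hc, hpos⟩ := exists_isSplitDiagonal (F := F) (p := p)
    (fun w => if (w.embedding f).im < 0 then Finset.univ.image (D.enum w.embedding)
      else Finset.univ.image (D.enum (ComplexEmbedding.conjugate w.embedding)))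
    (fun w => by
      split_ifs <;>
      rw [Finset.card_image_of_injective _ (D.injective _), Finset.card_univ, Fintype.card_fin])
  have hcre (τ : F →+* ℂ) (j) : τ (c j) = ((τ (c j)).re : ℂ) :=
    map_eq_re_of_cmConj_eq (hc.2.1 j) τ
  have hcne (τ : F →+* ℂ) (j) : (τ (c j)).re ≠ 0 :=
    re_ne_zero_of_cmConj_eq (hc.2.1 j) (hc.1 j) τ
  have hsign (τ : F →+* ℂ) (k) : (τ f).im * (τ (c (D.enum τ k))).re < 0 := by
    have hw := hpos (InfinitePlace.mk τ)
    have hmem (j) := (mem_positiveAt (c := c) (j := j)).symm.trans (Finset.ext_iff.mp hw j)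
    rcases InfinitePlace.embedding_mk_eq τ with h | h
    · have h1 := hmem (D.enum τ k)
      rw [h] at h1
      rcases (hfim τ).lt_or_gt with h2 | h2
      · rw [if_pos h2] at h1
        exact mul_neg_of_neg_of_pos h2 (h1.mpr (Finset.mem_image_of_mem _ (Finset.mem_univ k)))
      · rw [if_neg h2.not_gt] at h1
        refine mul_neg_of_pos_of_neg h2 (lt_of_le_of_ne (not_lt.mp fun h3 => ?_) (hcne τ _))
        obtain ⟨k', -, hk'⟩ := Finset.mem_image.mp (h1.mp h3)
        exact (D.mem_range_conjugate τ _).mp ⟨k', hk'⟩ ⟨k, rfl⟩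
    · have h1 := hmem (D.enum τ k)
      rw [h] at h1
      have e1 (x : F) : (ComplexEmbedding.conjugate τ x).im = - (τ x).im := by
        rw [ComplexEmbedding.conjugate_coe_eq, Complex.conj_im]
      have e2 (x : F) : (ComplexEmbedding.conjugate τ x).re = (τ x).re := by
        rw [ComplexEmbedding.conjugate_coe_eq, Complex.conj_re]
      rw [e1, e2, ComplexEmbedding.involutive_conjugate F τ] at h1
      rcases (hfim τ).lt_or_gt with h2 | h2
      · rw [if_neg (by linarith)] at h1
        exact mul_neg_of_neg_of_pos h2 (h1.mpr (Finset.mem_image_of_mem _ (Finset.mem_univ k)))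
      · rw [if_pos (by linarith)] at h1
        refine mul_neg_of_pos_of_neg h2 (lt_of_le_of_ne (not_lt.mp fun h3 => ?_) (hcne τ _))
        obtain ⟨k', -, hk'⟩ := Finset.mem_image.mp (h1.mp h3)
        exact (D.mem_range_conjugate τ _).mp ⟨k', hk'⟩ ⟨k, rfl⟩
  obtain ⟨N, hN0, hN⟩ := exists_integral_multiples ℤ ℚ (Finset.univ.image fun j => f * c j)
  -- The square makes the scaling factor positive whatever the sign of `N`; integrality is obtained
  -- from a single factor `N`.
  refine ⟨(N : F) ^ 2 * f, c, mul_ne_zero (pow_ne_zero 2 (Int.cast_ne_zero.mpr hN0)) hf0, ?_, hc,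
    fun j => ?_, fun τ k => ?_⟩
  · rw [map_mul, map_pow, map_intCast, hf, mul_neg]
  · have h1 := hN _ (Finset.mem_image_of_mem _ (Finset.mem_univ j))
    rw [zsmul_eq_mul] at h1
    have h2 : IsIntegral ℤ (N : F) := isIntegral_algebraMap (R := ℤ) (x := N)
    rw [show (N : F) ^ 2 * f * c j = N * (N * (f * c j)) by ring]
    exact h2.mul h1
  · have h1 : τ ((N : F) ^ 2 * f * c (D.enum τ k)) =
        (((N : ℝ) ^ 2 * (τ (c (D.enum τ k))).re : ℝ) : ℂ) * τ f := by
      rw [map_mul, map_mul, map_pow, map_intCast, Complex.ofReal_mul, ← hcre]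
      push_cast
      ring
    rw [h1, Complex.im_ofReal_mul]
    have h2 : (0 : ℝ) < (N : ℝ) ^ 2 := by positivity
    nlinarith [hsign τ k]

end WeilTypeConstruction
end ComplexAbelianVariety
end

/-! ### The complex torus attached to a combinatorial CM-type -/

noncomputable section

namespace ComplexAbelianVariety

open NumberField

namespace WeilCMType

section Lattice

variable {F : Type} [Field F] {p : ℕ} (D : WeilCMType F p)

/-- The complex vector space underlying the abelian variety attached to `D`. -/
abbrev TangentSpace (F : Type) [Field F] (p : ℕ) : Type u :=
  ULift.{u} ((F →+* ℂ) × Fin p) → ℂ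

/-- The embedding of `F^{2p}` into the tangent space. -/
def embed : (Fin (p + p) → F) →+ TangentSpace.{u} F p where
  toFun x i := i.down.1 (x (D.enum i.down.1 i.down.2))
  map_zero' := by funext i; simp
  map_add' x y := by funext i; simp

theorem embed_apply (x : Fin (p + p) → F) (i) :
    D.embed x i = i.down.1 (x (D.enum i.down.1 i.down.2)) := rfl

variable [NumberField F]

/-- The image in the tangent space of a `ℤ`-basis of `(𝓞 F)^{2p}`. -/
def latticeVector (x : Fin (p + p) × Module.Free.ChooseBasisIndex ℤ (𝓞 F)) :
    TangentSpace.{u} F p :=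
  D.embed (Pi.single x.1 (integralBasis F x.2))

/-- The coordinate `j` is visible at only one of τ and its conjugate. Since the coefficients of the
relation are real, conjugation recovers the relation at the other, so it holds at every embedding;
the canonical embedding of an integral basis is independent over `ℂ`. -/
theorem linearIndependent_latticeVector : LinearIndependent ℝ D.latticeVector.{u} := by
  classical
  rw [Fintype.linearIndependent_iff]
  intro g hg ⟨j, m⟩
  have h1 (τ : F →+* ℂ) (j : Fin (p + p)) (hj : ∃ k, D.enum τ k = j) :
      ∑ m, (g (j, m) : ℂ) * τ (integralBasis F m) = 0 := by
    obtain ⟨k, rfl⟩ := hj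
    have h := congrFun hg ⟨τ, k⟩
    simp only [Finset.sum_apply, Pi.smul_apply, latticeVector, embed_apply, Pi.zero_apply,
      Fintype.sum_prod_type, Complex.real_smul, Pi.single_apply] at h
    rw [Finset.sum_eq_single (D.enum τ k)] at h
    · simpa using h
    · intro j _ hj
      simp [hj.symm]
    · simp
  have h2 (τ : F →+* ℂ) (j : Fin (p + p)) :
      ∑ m, (g (j, m) : ℂ) * τ (integralBasis F m) = 0 := by
    rcases D.exists_mem_range τ j with h | h
    · exact h1 τ j h
    · have := congrArg (starRingEnd ℂ) (h1 _ j h)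
      simpa [ComplexEmbedding.conjugate_coe_eq] using this
  have h3 := (canonicalEmbedding.latticeBasis F).linearIndependent
  rw [Fintype.linearIndependent_iff] at h3
  have := h3 (fun m => (g (j, m) : ℂ)) (by
    funext τ
    simpa [canonicalEmbedding.latticeBasis_apply, Finset.sum_apply] using h2 τ j) m
  simpa using this

/-- A real basis of the tangent space that spans the lattice. -/
def realBasis :
    Module.Basis (Fin (p + p) × Module.Free.ChooseBasisIndex ℤ (𝓞 F)) ℝ (TangentSpace.{u} F p) :=
  basisOfLinearIndependentOfCardEqFinrank' D.latticeVector D.linearIndependent_latticeVector (by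
    rw [finrank_real_of_complex, Module.finrank_pi, Fintype.card_ulift, Fintype.card_prod,
      Fintype.card_prod, Embeddings.card, Fintype.card_fin, Fintype.card_fin,
      ← Module.finrank_eq_card_chooseBasisIndex, RingOfIntegers.rank]
    ring)

theorem realBasis_apply (x) : D.realBasis.{u} x = D.latticeVector x := by
  simp [realBasis]

/-- The lattice `(𝓞 F)^{2p}` in the tangent space. -/
def lattice : Submodule ℤ (TangentSpace.{u} F p) := Submodule.span ℤ (Set.range D.realBasis)

instance : DiscreteTopology D.lattice.{u} := by
  unfold lattice; infer_instance

instance : IsZLattice ℝ D.lattice.{u} := by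
  unfold lattice; infer_instance

theorem embed_mem_lattice {x : Fin (p + p) → F} (hx : ∀ j, IsIntegral ℤ (x j)) :
    D.embed x ∈ D.lattice.{u} := by
  classical
  have h1 (j) : ∃ a : Module.Free.ChooseBasisIndex ℤ (𝓞 F) → ℤ,
      x j = ∑ m, a m • integralBasis F m := by
    refine ⟨(RingOfIntegers.basis F).repr ⟨x j, hx j⟩, ?_⟩
    have := congrArg (algebraMap (𝓞 F) F) ((RingOfIntegers.basis F).sum_repr ⟨x j, hx j⟩)
    rw [map_sum] at this
    simp only [map_zsmul, ← integralBasis_apply] at this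
    exact this.symm
  choose a ha using h1
  have h2 (j) : (Pi.single j (x j) : Fin (p + p) → F) =
      ∑ m, a j m • Pi.single j (integralBasis F m) := by
    rw [ha j]
    funext i
    by_cases hi : i = j
    · subst hi
      simp
    · simp [hi]
  rw [← Finset.univ_sum_single x, map_sum]
  refine Submodule.sum_mem _ fun j _ => ?_
  rw [h2, map_sum]
  refine Submodule.sum_mem _ fun m _ => ?_
  rw [map_zsmul]
  exact D.lattice.smul_mem _ (Submodule.subset_span ⟨(j, m), D.realBasis_apply _⟩)

theorem exists_of_mem_lattice {z : TangentSpace.{u} F p} (hz : z ∈ D.lattice) :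
    ∃ x, (∀ j, IsIntegral ℤ (x j)) ∧ D.embed x = z := by
  classical
  unfold lattice at hz
  induction hz using Submodule.span_induction with
  | mem z hz =>
    obtain ⟨⟨j, m⟩, rfl⟩ := hz
    refine ⟨Pi.single j (integralBasis F m), fun i => ?_, (D.realBasis_apply (j, m)).symm⟩
    by_cases h : i = j
    · subst h
      rw [Pi.single_eq_same, integralBasis_apply]
      exact RingOfIntegers.isIntegral_coe _
    · rw [Pi.single_eq_of_ne h]
      exact isIntegral_zero
  | zero => exact ⟨0, fun _ => isIntegral_zero, map_zero _⟩
  | add z w _ _ hz hw =>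
    obtain ⟨x, hx, rfl⟩ := hz
    obtain ⟨y, hy, rfl⟩ := hw
    exact ⟨x + y, fun j => (hx j).add (hy j), map_add _ _ _⟩
  | smul a z _ hz =>
    obtain ⟨x, hx, rfl⟩ := hz
    exact ⟨a • x, fun j => (hx j).smul a, map_zsmul _ _ _⟩

theorem embed_injective : Function.Injective D.embed.{u} := by
  refine (injective_iff_map_eq_zero _).mpr fun x hx => funext fun j => ?_
  have h (τ : F →+* ℂ) (hj : ∃ k, D.enum τ k = j) : x j = 0 := by
    obtain ⟨k, rfl⟩ := hj
    exact (map_eq_zero τ).mp (congrFun hx ⟨τ, k⟩)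
  obtain ⟨τ⟩ : Nonempty (F →+* ℂ) := inferInstance
  rcases D.exists_mem_range τ j with hj | hj
  · exact h _ hj
  · exact h _ hj

end Lattice

/-! ### The Riemann form on the torus -/

section Form

variable {F : Type} [Field F] {p : ℕ} (D : WeilCMType F p) [NumberField F]

/-- The real bilinear form on the tangent space that extends `(x, y) ↦ Tr (∑ aⱼ xⱼ ȳⱼ)`. -/
def form (a : Fin (p + p) → F) :
    TangentSpace.{u} F p →ₗ[ℝ] TangentSpace.{u} F p →ₗ[ℝ] ℝ :=
  LinearMap.mk₂ ℝ
    (fun z w => ∑ i, 2 * (i.down.1 (a (D.enum i.down.1 i.down.2)) * z i *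
      starRingEnd ℂ (w i)).re)
    (fun z z' w => by
      rw [← Finset.sum_add_distrib]
      refine Finset.sum_congr rfl fun i _ => ?_
      simp only [Pi.add_apply, mul_add, add_mul, Complex.add_re])
    (fun r z w => by
      rw [smul_eq_mul, Finset.mul_sum]
      refine Finset.sum_congr rfl fun i _ => ?_
      rw [Pi.smul_apply, Complex.real_smul, mul_left_comm, mul_assoc, Complex.re_ofReal_mul]
      ring)
    (fun z w w' => by
      rw [← Finset.sum_add_distrib]
      refine Finset.sum_congr rfl fun i _ => ?_
      simp only [Pi.add_apply, map_add, mul_add, Complex.add_re])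
    (fun r z w => by
      rw [smul_eq_mul, Finset.mul_sum]
      refine Finset.sum_congr rfl fun i _ => ?_
      rw [Pi.smul_apply, Complex.real_smul, map_mul, Complex.conj_ofReal, mul_left_comm,
        Complex.re_ofReal_mul]
      ring)

theorem form_apply (a : Fin (p + p) → F) (z w : TangentSpace.{u} F p) :
    D.form a z w = ∑ i, 2 * (i.down.1 (a (D.enum i.down.1 i.down.2)) * z i *
      starRingEnd ℂ (w i)).re := rfl

variable [IsCMField F]

/-- The trace is a sum over all embeddings τ and all coordinates `j`. The coordinates not enumerated
at τ are those enumerated at its conjugate, so after reindexing they contribute the complex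
conjugates of the others. This is the origin of twice the real part in `form`. -/
theorem form_embed (a x y : Fin (p + p) → F) :
    D.form a (D.embed.{u} x) (D.embed y) =
      ((Algebra.trace ℚ F (∑ j, a j * x j * cmConj F (y j)) : ℚ) : ℝ) := by
  classical
  set b : Fin (p + p) → F := fun j => a j * x j * cmConj F (y j) with hb
  have h1 (i) : (ULift.down.{u} i).1 (a (D.enum i.down.1 i.down.2)) * D.embed x i *
      starRingEnd ℂ (D.embed y i) = i.down.1 (b (D.enum i.down.1 i.down.2)) := by
    rw [embed_apply, embed_apply, ← map_cmConj, ← map_mul, ← map_mul]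
  have h2 (τ : F →+* ℂ) : τ (∑ j, b j) = ∑ k, τ (b (D.enum τ k)) +
      ∑ k, τ (b (D.enum (ComplexEmbedding.conjugate τ) k)) := by
    have e1 : ∑ k, τ (b (D.enum τ k)) = ∑ j ∈ Finset.univ.image (D.enum τ), τ (b j) :=
      (Finset.sum_image (f := fun j => τ (b j)) (fun _ _ _ _ h => D.injective τ h)).symm
    have e2 : ∑ k, τ (b (D.enum (ComplexEmbedding.conjugate τ) k)) =
        ∑ j ∈ (Finset.univ.image (D.enum τ))ᶜ, τ (b j) := by
      have : (Finset.univ.image (D.enum τ))ᶜ =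
          Finset.univ.image (D.enum (ComplexEmbedding.conjugate τ)) := by
        ext j
        have := D.mem_range_conjugate τ j
        simpa using this.symm
      rw [this]
      exact (Finset.sum_image (f := fun j => τ (b j))
        (fun _ _ _ _ h => D.injective (ComplexEmbedding.conjugate τ) h)).symm
    rw [e1, e2, Finset.sum_add_sum_compl, map_sum]
  have h3 : ((Algebra.trace ℚ F (∑ j, b j) : ℚ) : ℂ) = ∑ τ : F →+* ℂ, τ (∑ j, b j) := by
    have := trace_eq_sum_embeddings (K := ℚ) (L := F) ℂ (x := ∑ j, b j)
    rw [eq_ratCast] at this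
    rw [this]
    exact (Fintype.sum_equiv (RingHom.equivRatAlgHom F ℂ) _ _ (fun _ => rfl)).symm
  apply Complex.ofReal_injective
  rw [Complex.ofReal_ratCast, h3, form_apply]
  simp only [h1, h2]
  rw [Finset.sum_add_distrib]
  have h4 : ∑ τ : F →+* ℂ, ∑ k, τ (b (D.enum (ComplexEmbedding.conjugate τ) k)) =
      ∑ τ : F →+* ℂ, ∑ k, starRingEnd ℂ (τ (b (D.enum τ k))) := by
    refine Fintype.sum_equiv (Function.Involutive.toPerm _ (ComplexEmbedding.involutive_conjugate F)) _ _ fun τ => ?_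
    simp [ComplexEmbedding.conjugate_coe_eq]
  rw [h4, ← Finset.sum_add_distrib]
  simp only [← Finset.sum_add_distrib, Complex.add_conj]
  rw [← Fintype.sum_prod_type', Complex.ofReal_sum]
  exact Fintype.sum_equiv Equiv.ulift _ _ fun _ => rfl

/-- Since each `τ (a j)` is purely imaginary, the diagonal values vanish, while inserting `I` turns
the coefficient of `|z i|²` into `-2` times its imaginary part, whence the sign in `hneg`. -/
theorem isRiemannForm_form {a : Fin (p + p) → F} (ha : ∀ j, cmConj F (a j) = - a j)
    (hint : ∀ j, IsIntegral ℤ (a j)) (hneg : ∀ (τ : F →+* ℂ) k, (τ (a (D.enum τ k))).im < 0) :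
    IsRiemannForm D.lattice (D.form.{u} a) where
  alternating z := by
    rw [form_apply]
    refine Finset.sum_eq_zero fun i _ => ?_
    have h := map_cmConj i.down.1 (a (D.enum i.down.1 i.down.2))
    rw [ha, map_neg] at h
    have h := congrArg Complex.re h
    rw [Complex.neg_re, Complex.conj_re] at h
    rw [mul_assoc, Complex.mul_conj, Complex.re_mul_ofReal]
    have : (i.down.1 (a (D.enum i.down.1 i.down.2))).re = 0 := by linarith
    rw [this]; ring
  integral z hz w hw := by
    obtain ⟨x, hx, rfl⟩ := D.exists_of_mem_lattice hz
    obtain ⟨y, hy, rfl⟩ := D.exists_of_mem_lattice hw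
    rw [form_embed]
    have h : IsIntegral ℤ (Algebra.trace ℚ F (∑ j, a j * x j * cmConj F (y j))) := by
      refine Algebra.isIntegral_trace (IsIntegral.sum _ fun j _ => ?_)
      exact ((hint j).mul (hx j)).mul ((hy j).map (cmConj F).toIntAlgHom)
    obtain ⟨n, hn⟩ := IsIntegrallyClosed.isIntegral_iff.mp h
    exact ⟨n, by rw [← hn]; simp⟩
  map_I z w := by
    rw [form_apply, form_apply]
    refine Finset.sum_congr rfl fun i _ => ?_
    congr 2
    simp only [Pi.smul_apply, smul_eq_mul, map_mul, Complex.conj_I]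
    linear_combination (-(i.down.1 (a (D.enum i.down.1 i.down.2)) * z i * starRingEnd ℂ (w i))) *
      Complex.I_mul_I
  pos z hz := by
    have h (i) : 2 * ((ULift.down.{u} i).1 (a (D.enum i.down.1 i.down.2)) * (Complex.I • z) i *
        starRingEnd ℂ (z i)).re =
        -2 * (i.down.1 (a (D.enum i.down.1 i.down.2))).im * Complex.normSq (z i) := by
      rw [Pi.smul_apply, smul_eq_mul, mul_assoc, mul_assoc, Complex.mul_conj, ← mul_assoc,
        Complex.re_mul_ofReal, Complex.mul_I_re]
      ring
    rw [form_apply]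
    simp only [h]
    obtain ⟨i, hi⟩ := Function.ne_iff.mp hz
    refine Finset.sum_pos' (fun i _ => ?_) ⟨i, Finset.mem_univ i, ?_⟩
    · have := hneg i.down.1 i.down.2
      exact mul_nonneg (by linarith) (Complex.normSq_nonneg _)
    · have := hneg i.down.1 i.down.2
      exact mul_pos (by linarith) (Complex.normSq_pos.mpr hi)

end Form

end WeilCMType
end ComplexAbelianVariety
end

/-! ### The Hodge decomposition of the first cohomology -/

noncomputable section

namespace ComplexAbelianVariety

section Homology

variable {A : ComplexAbelianVariety.{u}}

theorem mem_homology_of_nsmul_mem {n : ℕ} (hn : n ≠ 0) {x : A.V} (h : n • x ∈ A.lattice) :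
    x ∈ A.Homology := by
  refine (Submodule.smul_mem_iff A.Homology (Nat.cast_ne_zero.mpr hn : (n : ℚ) ≠ 0)).mp ?_
  rw [Nat.cast_smul_eq_nsmul]
  exact Submodule.subset_span h

instance instModuleFiniteHomology : Module.Finite ℚ A.Homology := by
  obtain ⟨s, hs⟩ := ZLattice.FG ℝ A.lattice
  refine Module.Finite.iff_fg.mpr ⟨s, le_antisymm (Submodule.span_mono ?_) ?_⟩
  · rw [← hs]
    exact Submodule.subset_span
  · refine Submodule.span_le.mpr fun x hx => ?_
    rw [← hs] at hx
    exact Submodule.span_subset_span ℤ ℚ _ hx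

theorem span_real_homology : Submodule.span ℝ (A.Homology : Set A.V) = ⊤ :=
  top_le_iff.mp <| (IsZLattice.span_top (K := ℝ) (L := A.lattice)).symm.le.trans
    (Submodule.span_mono Submodule.subset_span)

theorem realLinearMap_ext {M : Type*} [AddCommGroup M] [Module ℝ M] {f g : A.V →ₗ[ℝ] M}
    (h : ∀ x : A.Homology, f x = g x) : f = g :=
  LinearMap.ext_on span_real_homology fun x hx => h ⟨x, hx⟩

theorem cohomology1_ext_lattice {M : Type*} [AddCommGroup M] [Module ℚ M]
    {ω η : A.Cohomology1 M}
    (h : ∀ (x : A.V) (hx : x ∈ A.lattice),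
      ω ⟨x, Submodule.subset_span hx⟩ = η ⟨x, Submodule.subset_span hx⟩) : ω = η := by
  ext ⟨x, hx⟩
  induction hx using Submodule.span_induction with
  | mem x hx => exact h x hx
  | zero => exact (map_zero ω).trans (map_zero η).symm
  | add x y hx hy h1 h2 =>
    have := congrArg₂ (· + ·) h1 h2
    simp only [← map_add] at this
    exact this
  | smul a x hx h1 =>
    have := congrArg (a • ·) h1
    simp only [← map_smul] at this
    exact this

/-- Every class in `H¹(A, ℂ)` extends to a real-linear form on the tangent space. -/
theorem exists_realLinearMap (ω : A.Cohomology1 ℂ) :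
    ∃ L : A.V →ₗ[ℝ] ℂ, ∀ x : A.Homology, ω x = L x := by
  let b := Module.Free.chooseBasis ℤ A.lattice
  let i : A.lattice →ₗ[ℤ] A.Homology :=
    { toFun := fun x => ⟨x, Submodule.subset_span x.2⟩
      map_add' := fun x y => rfl
      map_smul' := fun n x => rfl }
  let L : A.V →ₗ[ℝ] ℂ := (b.ofZLatticeBasis ℝ A.lattice).constr ℝ fun k => ω (i (b k))
  have h1 : (ω.toAddMonoidHom.toIntLinearMap ∘ₗ i) =
      (L.toAddMonoidHom.toIntLinearMap ∘ₗ A.lattice.subtype) := by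
    refine b.ext fun k => ?_
    have := (b.ofZLatticeBasis ℝ A.lattice).constr_basis ℝ (fun k => ω (i (b k))) k
    rw [Module.Basis.ofZLatticeBasis_apply] at this
    exact this.symm
  refine ⟨L, fun x => ?_⟩
  have h2 : ω = L.toAddMonoidHom.toRatLinearMap ∘ₗ A.Homology.subtype :=
    cohomology1_ext_lattice fun x hx => LinearMap.congr_fun h1 ⟨x, hx⟩
  rw [h2]
  rfl

/-- `H^{0,1}` as a complex subspace of `H¹(A, ℂ)`. -/
def hodge01Submodule (A : ComplexAbelianVariety.{u}) : Submodule ℂ (A.Cohomology1 ℂ) where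
  carrier := A.hodge01
  add_mem' := by
    rintro _ _ ⟨ω, hω, h⟩ ⟨ω', hω', h'⟩
    exact ⟨ω + ω', add_mem hω hω', fun x => by simp [h, h']⟩
  zero_mem' := ⟨0, zero_mem _, fun x => by simp⟩
  smul_mem' := by
    rintro c _ ⟨ω, hω, h⟩
    exact ⟨starRingEnd ℂ c • ω, Submodule.smul_mem _ _ hω, fun x => by simp [h]⟩

theorem comp_homologyEnd_mem_hodge01 (φ : A.End0) {ω : A.Cohomology1 ℂ} (hω : ω ∈ A.hodge01) :
    ω ∘ₗ A.homologyEnd φ ∈ A.hodge01 := by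
  obtain ⟨η, hη, h⟩ := hω
  exact ⟨_, comp_homologyEnd_mem_hodge10 φ hη, fun x => h _⟩

/-- The complex conjugate of a class in `H¹(A, ℂ)`. -/
def conjCohomology1 (ω : A.Cohomology1 ℂ) : A.Cohomology1 ℂ :=
  (starRingEnd ℂ).toAddMonoidHom.toRatLinearMap ∘ₗ ω

theorem conjCohomology1_apply (ω : A.Cohomology1 ℂ) (x) :
    conjCohomology1 ω x = starRingEnd ℂ (ω x) := rfl

theorem conjCohomology1_mem_hodge01 {ω : A.Cohomology1 ℂ} :
    conjCohomology1 ω ∈ A.hodge01 ↔ ω ∈ A.hodge10 := by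
  refine ⟨fun ⟨η, hη, h⟩ => ?_, fun h => ⟨ω, h, fun _ => rfl⟩⟩
  have : ω = η := LinearMap.ext fun x => (starRingEnd ℂ).injective (h x)
  rwa [this]

theorem conjCohomology1_mem_hodge10 {ω : A.Cohomology1 ℂ} :
    conjCohomology1 ω ∈ A.hodge10 ↔ ω ∈ A.hodge01 := by
  refine ⟨fun h => ⟨_, h, fun x => by simp [conjCohomology1_apply]⟩, fun ⟨η, hη, h⟩ => ?_⟩
  have : conjCohomology1 ω = η := LinearMap.ext fun x => by simp [conjCohomology1_apply, h]
  rwa [this]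

/-- A real-linear form is the sum of a complex-linear and a conjugate-linear one. -/
theorem exists_add_hodge (ω : A.Cohomology1 ℂ) :
    ∃ ω₁ ∈ A.hodge10, ∃ ω₂ ∈ A.hodge01, ω = ω₁ + ω₂ := by
  obtain ⟨L, hL⟩ := exists_realLinearMap ω
  have key : ∀ (ω : A.Cohomology1 ℂ) (L : A.V →ₗ[ℝ] ℂ), (∀ x : A.Homology, ω x = L x) →
      ∃ ω₁ ∈ A.hodge10, ∀ x : A.Homology, ω₁ x = (L x - Complex.I * L (Complex.I • (x : A.V))) / 2 := by
    intro ω L hL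
    let l : A.V →ₗ[ℂ] ℂ :=
      { toFun := fun x => (L x - Complex.I * L (Complex.I • x)) / 2
        map_add' := fun x y => by
          rw [smul_add, map_add, map_add]; ring
        map_smul' := fun c x => by
          have h1 (y : A.V) : L (c • y) = c.re * L y + c.im * L (Complex.I • y) := by
            have : c • y = c.re • y + c.im • (Complex.I • y) := by
              rw [← Complex.coe_smul, ← Complex.coe_smul, smul_smul, ← add_smul, Complex.re_add_im]
            rw [this, map_add, map_smul, map_smul, Complex.real_smul, Complex.real_smul]
          have h2 : L (Complex.I • Complex.I • x) = - L x := by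
            rw [smul_smul, Complex.I_mul_I, neg_smul, one_smul, map_neg]
          rw [smul_comm Complex.I c x, h1, h1, h2, RingHom.id_apply, smul_eq_mul]
          conv_rhs => rw [← Complex.re_add_im c]
          linear_combination (c.im * L (Complex.I • x) / 2) * Complex.I_mul_I }
    exact ⟨(l.restrictScalars ℚ) ∘ₗ A.Homology.subtype, ⟨l, fun x => rfl⟩, fun x => rfl⟩
  obtain ⟨ω₁, h1, e1⟩ := key ω L hL
  -- The (0,1) part is the conjugate of the (1,0) part of the conjugate form.
  obtain ⟨ω₂, h2, e2⟩ := key (conjCohomology1 ω) (Complex.conjLIE.toLinearEquiv.toLinearMap ∘ₗ L)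
    (fun x => by simp [conjCohomology1_apply, hL])
  refine ⟨ω₁, h1, conjCohomology1 ω₂, conjCohomology1_mem_hodge01.mpr h2, LinearMap.ext fun x => ?_⟩
  rw [LinearMap.add_apply, conjCohomology1_apply, e1, e2, hL]
  simp [Complex.conj_ofNat]
  ring

/-- Homology spans the tangent space over `ℝ`, so a form of both types extends to one that is
complex-linear and conjugate-linear at once. -/
theorem eq_zero_of_mem_hodge10_of_mem_hodge01 {ω : A.Cohomology1 ℂ} (h1 : ω ∈ A.hodge10)
    (h2 : ω ∈ A.hodge01) : ω = 0 := by
  obtain ⟨l, hl⟩ := h1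
  obtain ⟨η, ⟨m, hm⟩, h⟩ := h2
  have e : l.restrictScalars ℝ =
      Complex.conjLIE.toLinearEquiv.toLinearMap ∘ₗ m.restrictScalars ℝ :=
    realLinearMap_ext fun x => by
      have := hl x
      rw [h, hm] at this
      exact this.symm
  have e' (x : A.V) : l x = starRingEnd ℂ (m x) := LinearMap.congr_fun e x
  refine LinearMap.ext fun x => ?_
  have h3 := e' (Complex.I • (x : A.V))
  rw [map_smul, map_smul, smul_eq_mul, smul_eq_mul, map_mul, Complex.conj_I, ← e'] at h3
  have h4 : 2 * Complex.I * l x = 0 := by linear_combination h3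
  rw [hl x, LinearMap.zero_apply]
  simpa using h4

end Homology

end ComplexAbelianVariety
end

/-! ### The abelian variety, its action of `F` and its homology -/

noncomputable section

namespace ComplexAbelianVariety

open NumberField

namespace WeilCMType

variable {F : Type} [Field F] {p : ℕ} (D : WeilCMType F p) [NumberField F]

/-- The action of `F` on the tangent space. -/
def actionEnd : F →+* Module.End ℂ (TangentSpace.{u} F p) where
  toFun a :=
    { toFun := fun z i => i.down.1 a * z i
      map_add' := fun z w => by funext i; simp [mul_add]
      map_smul' := fun c z => by funext i; simp [mul_left_comm] }
  map_one' := by ext z i; simp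
  map_mul' a b := by ext z i; simp [mul_assoc]
  map_zero' := by ext z i; simp
  map_add' a b := by ext z i; simp [add_mul]

theorem actionEnd_apply (a : F) (z : TangentSpace.{u} F p) (i) :
    actionEnd a z i = i.down.1 a * z i := rfl

theorem actionEnd_embed (a : F) (x : Fin (p + p) → F) :
    actionEnd a (D.embed.{u} x) = D.embed (a • x) := by
  funext i
  simp [actionEnd_apply, embed_apply]

theorem exists_nat_mul_isIntegral {ι : Type*} [Finite ι] (x : ι → F) :
    ∃ n : ℕ, n ≠ 0 ∧ ∀ j, IsIntegral ℤ ((n : F) * x j) := by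
  classical
  have := Fintype.ofFinite ι
  obtain ⟨N, hN0, hN⟩ := exists_integral_multiples ℤ ℚ (Finset.univ.image x)
  refine ⟨N.natAbs, Int.natAbs_ne_zero.mpr hN0, fun j => ?_⟩
  have h1 := hN _ (Finset.mem_image_of_mem _ (Finset.mem_univ j))
  rw [zsmul_eq_mul] at h1
  rcases Int.natAbs_eq N with h | h
  · rw [h] at h1
    simpa using h1
  · rw [h] at h1
    simpa using h1.neg

variable [IsCMField F]

/-- The abelian variety with first homology `F^{2p}` attached to `D`. -/
def toVariety : ComplexAbelianVariety.{u} where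
  V := TangentSpace.{u} F p
  lattice := D.lattice
  polarizable := by
    obtain ⟨f, c, -, hf, hc, hint, hneg⟩ := D.exists_coefficients
    refine ⟨D.form fun j => f * c j, D.isRiemannForm_form (fun j => ?_) hint hneg⟩
    rw [map_mul, hf, hc.2.1, neg_mul]

/-- The homomorphism `F → End⁰`. -/
def action : F →+* (D.toVariety.{u}).End0 :=
  (actionEnd.{u} (F := F) (p := p)).codRestrict (D.toVariety.{u}).End0 fun a => by
    obtain ⟨n, hn, h⟩ := exists_nat_mul_isIntegral (fun _ : Unit => a)
    refine ⟨n, hn, fun z hz => ?_⟩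
    obtain ⟨x, hx, rfl⟩ := D.exists_of_mem_lattice hz
    have key : n • actionEnd a (D.embed.{u} x) ∈ D.lattice := by
      rw [actionEnd_embed, ← map_nsmul]
      refine D.embed_mem_lattice fun j => ?_
      rw [Pi.smul_apply, Pi.smul_apply, smul_eq_mul, nsmul_eq_mul, ← mul_assoc]
      exact (h ()).mul (hx j)
    exact key

theorem embed_mem_homology (x : Fin (p + p) → F) :
    D.embed x ∈ (D.toVariety.{u}).Homology := by
  obtain ⟨n, hn, h⟩ := exists_nat_mul_isIntegral x
  have key : n • D.embed.{u} x ∈ D.lattice := by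
    rw [← map_nsmul]
    refine D.embed_mem_lattice fun j => ?_
    rw [Pi.smul_apply, nsmul_eq_mul]
    exact h j
  exact mem_homology_of_nsmul_mem hn key

/-- The map `F^{2p} → H₁`. -/
def toHomology : letI := homologyModule D.action.{u}
    (Fin (p + p) → F) →ₗ[F] (D.toVariety.{u}).Homology :=
  letI := homologyModule D.action.{u}
  { toFun := fun x => ⟨D.embed x, D.embed_mem_homology x⟩
    map_add' := fun x y => Subtype.ext (map_add D.embed x y)
    map_smul' := fun a x => Subtype.ext (D.actionEnd_embed a x).symm }

theorem toHomology_bijective : Function.Bijective D.toHomology.{u} := by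
  refine ⟨fun x y h => D.embed_injective (congrArg Subtype.val h), fun z => ?_⟩
  obtain ⟨z, hz⟩ := z
  suffices ∃ x, D.embed x = z from this.imp fun x hx => Subtype.ext hx
  induction hz using Submodule.span_induction with
  | mem z hz => exact (D.exists_of_mem_lattice hz).imp fun x hx => hx.2
  | zero => exact ⟨0, map_zero _⟩
  | add z w _ _ hz hw =>
    obtain ⟨x, rfl⟩ := hz
    obtain ⟨y, rfl⟩ := hw
    exact ⟨x + y, map_add _ _ _⟩
  | smul a z _ hz =>
    obtain ⟨x, rfl⟩ := hz
    exact ⟨a • x, map_rat_smul D.embed a x⟩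

/-- `H₁` is `F^{2p}` as an `F`-vector space. -/
def homologyEquiv : letI := homologyModule D.action.{u}
    (Fin (p + p) → F) ≃ₗ[F] (D.toVariety.{u}).Homology :=
  letI := homologyModule D.action.{u}
  LinearEquiv.ofBijective D.toHomology D.toHomology_bijective

/-- The degree is defined through cohomology while the structure is known on homology; comparing
dimensions over `ℚ` avoids dualizing over `F`. -/
theorem weilDegree_action : weilDegree D.action.{u} = p + p := by
  let := homologyModule D.action.{u}
  let := cohomology1Module D.action.{u} ℚ
  have h1 : Module.finrank ℚ ((D.toVariety.{u}).Cohomology1 ℚ) =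
      Module.finrank ℚ F * (p + p) := by
    rw [Module.finrank_linearMap, Module.finrank_self, mul_one,
      ← (D.homologyEquiv.restrictScalars ℚ).finrank_eq, Module.finrank_pi_fintype]
    simp [mul_comm]
  have h2 : Module.finrank ℚ F * Module.finrank F ((D.toVariety.{u}).Cohomology1 ℚ) =
      Module.finrank ℚ ((D.toVariety.{u}).Cohomology1 ℚ) :=
    Module.finrank_mul_finrank ℚ F _
  rw [h1] at h2
  exact Nat.eq_of_mul_eq_mul_left Module.finrank_pos h2

end WeilCMType
end ComplexAbelianVariety
end

/-! ### Weil type: freeness over `F ⊗ ℂ` -/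

noncomputable section

namespace ComplexAbelianVariety

open NumberField

/-- The map `F ⊗ ℂ → ∏ ℂ` given by the complex embeddings of `F`. -/
def tensorToPi (F : Type) [Field F] [CharZero F] : F ⊗[ℚ] ℂ →ₗ[ℚ] ((F →+* ℂ) → ℂ) :=
  TensorProduct.lift <| LinearMap.mk₂ ℚ (fun a z τ => τ a * z)
    (fun a b z => by funext τ; simp [add_mul])
    (fun q a z => by
      funext τ
      rw [map_rat_smul, smul_mul_assoc]
      rfl)
    (fun a z w => by funext τ; simp [mul_add])
    (fun q a z => by
      funext τ
      rw [mul_smul_comm]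
      rfl)

theorem tensorToPi_tmul {F : Type} [Field F] [CharZero F] (a : F) (z : ℂ) (τ : F →+* ℂ) :
    tensorToPi F (a ⊗ₜ z) τ = τ a * z := rfl

/-- In terms of an integral basis, the map sends coefficients in `ℂ` to the corresponding
combination of `canonicalEmbedding.latticeBasis`, which is a complex basis of the target. -/
theorem tensorToPi_bijective (F : Type) [Field F] [NumberField F] :
    Function.Bijective (tensorToPi F) := by
  let e := (TensorProduct.equivFinsuppOfBasisLeft (N := ℂ) (integralBasis F)).symm
  have h : ∀ z, tensorToPi F (e z) =
      (canonicalEmbedding.latticeBasis F).equivFun.symm (Finsupp.equivFunOnFinite z) := by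
    intro z
    rw [Module.Basis.equivFun_symm_apply]
    simp only [e, TensorProduct.equivFinsuppOfBasisLeft_symm_apply]
    rw [Finsupp.sum_fintype _ _ (by simp), map_sum]
    funext τ
    simp only [Finset.sum_apply, tensorToPi_tmul, canonicalEmbedding.latticeBasis_apply,
      Pi.smul_apply, canonicalEmbedding.apply_at, smul_eq_mul]
    exact Finset.sum_congr rfl fun m _ => mul_comm _ _
  have h2 : Function.Bijective (tensorToPi F ∘ e) := by
    have : (tensorToPi F ∘ e) = (canonicalEmbedding.latticeBasis F).equivFun.symm ∘
        Finsupp.equivFunOnFinite := funext h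
    rw [this]
    exact (LinearEquiv.bijective _).comp (Equiv.bijective _)
  exact (Function.Bijective.of_comp_iff _ e.bijective).mp h2

namespace WeilCMType

variable {F : Type} [Field F] {p : ℕ} (D : WeilCMType F p) [NumberField F]

/-- The linear form on the tangent space with given coefficients. -/
def coordinateForm (a : ULift.{u} ((F →+* ℂ) × Fin p) → ℂ) : TangentSpace.{u} F p →ₗ[ℂ] ℂ :=
  ∑ i, a i • LinearMap.proj i

theorem coordinateForm_apply (a : ULift.{u} ((F →+* ℂ) × Fin p) → ℂ) (z) :
    coordinateForm a z = ∑ i, a i * z i := by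
  simp [coordinateForm]

variable [IsCMField F]

/-- A homology class as an element of the tangent space. -/
def homologyVector (x : (D.toVariety.{u}).Homology) : TangentSpace.{u} F p := x.1

/-- The class in `H^{1,0}` that is the sum of the coordinates with a given second index. -/
def hodgeGenerator (k : Fin p) : (D.toVariety.{u}).hodge10 :=
  ⟨((coordinateForm (F := F) (fun i => if i.down.2 = k then 1 else 0)).restrictScalars ℚ) ∘ₗ
    (D.toVariety.{u}).Homology.subtype, _, fun _ => rfl⟩

theorem smul_hodgeGenerator_apply (t : F ⊗[ℚ] ℂ) (k : Fin p) (x : (D.toVariety.{u}).Homology) :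
    letI := hodge10TensorModule D.action.{u}
    (t • D.hodgeGenerator k).1 x =
      ∑ τ : F →+* ℂ, tensorToPi F t τ * (D.homologyVector x) ⟨τ, k⟩ := by
  let := hodge10TensorModule D.action.{u}
  induction t with
  | zero => simp
  | add s t hs ht =>
    rw [add_smul, map_add]
    simp only [Pi.add_apply, add_mul, Finset.sum_add_distrib]
    exact congrArg₂ (· + ·) hs ht
  | tmul a z =>
    have h1 : ((a ⊗ₜ[ℚ] z) • D.hodgeGenerator k).1 x = z *
        coordinateForm (F := F) (fun i => if i.down.2 = k then 1 else 0)
          (actionEnd a (D.homologyVector x)) := rfl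
    rw [h1, coordinateForm_apply, ← Equiv.sum_comp Equiv.ulift.symm, Fintype.sum_prod_type,
      Finset.mul_sum]
    refine Finset.sum_congr rfl fun τ _ => ?_
    simp [actionEnd_apply, tensorToPi_tmul]
    ring

/-- Each embedding τ occurs `p` times among the holomorphic coordinates. Grouping the coordinates by
their second index `k` gives `p` blocks, each a copy of `∏ ℂ ≅ F ⊗ ℂ` generated by `hodgeGenerator
k`. -/
theorem isWeilType_action : IsWeilType D.action.{u} := by
  classical
  let := hodge10TensorModule D.action.{u}
  let Θ : (Fin p → F ⊗[ℚ] ℂ) →ₗ[F ⊗[ℚ] ℂ] (D.toVariety.{u}).hodge10 :=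
    Fintype.linearCombination (F ⊗[ℚ] ℂ) D.hodgeGenerator
  have hΘ (t) (x : (D.toVariety.{u}).Homology) : (Θ t).1 x =
      coordinateForm (fun i => tensorToPi F (t i.down.2) i.down.1) (D.homologyVector x) := by
    have h1 : (Θ t).1 x = ∑ k, (t k • D.hodgeGenerator k).1 x := by
      simp only [Θ, Fintype.linearCombination_apply]
      rw [AddSubmonoidClass.coe_finsetSum, LinearMap.sum_apply]
    rw [h1, coordinateForm_apply, ← Equiv.sum_comp Equiv.ulift.symm, Fintype.sum_prod_type_right]
    exact Finset.sum_congr rfl fun k _ => D.smul_hodgeGenerator_apply _ k x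
  refine Module.Free.of_equiv (LinearEquiv.ofBijective Θ ⟨?_, ?_⟩)
  · refine (injective_iff_map_eq_zero Θ).mpr fun t ht => ?_
    have h1 : (coordinateForm fun i => tensorToPi F (t i.down.2) i.down.1).restrictScalars ℝ =
        (0 : TangentSpace.{u} F p →ₗ[ℝ] ℂ) := by
      refine realLinearMap_ext (A := D.toVariety.{u}) fun x => ?_
      have := hΘ t x
      rw [ht] at this
      exact this.symm
    funext k
    refine (tensorToPi_bijective F).1 ?_
    rw [Pi.zero_apply, map_zero]
    funext τ
    have h2 := LinearMap.congr_fun h1 (Pi.single ⟨τ, k⟩ 1)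
    rw [LinearMap.restrictScalars_apply, coordinateForm_apply] at h2
    simpa [Pi.single_apply] using h2
  · rintro ⟨ω, l, hl⟩
    choose g hg using (tensorToPi_bijective F).2
    let l' : TangentSpace.{u} F p →ₗ[ℂ] ℂ := l
    refine ⟨fun k => g fun τ => l' (Pi.single ⟨τ, k⟩ 1), Subtype.ext (LinearMap.ext fun x => ?_)⟩
    rw [hΘ, hl, coordinateForm_apply]
    simp only [hg]
    change _ = l' (D.homologyVector x)
    conv_rhs => rw [← Finset.univ_sum_single (D.homologyVector x), map_sum]
    refine Finset.sum_congr rfl fun i _ => ?_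
    have : (Pi.single i (D.homologyVector x i) : TangentSpace.{u} F p) =
        D.homologyVector x i • Pi.single i 1 := by
      rw [← Pi.single_smul, smul_eq_mul, mul_one]
    rw [this, map_smul, smul_eq_mul, mul_comm]

end WeilCMType
end ComplexAbelianVariety
end

/-! ### Split Weil type, Weil classes and homomorphisms to the torus -/

noncomputable section

namespace ComplexAbelianVariety

open NumberField

namespace WeilCMType

variable {F : Type} [Field F] {p : ℕ} (D : WeilCMType F p) [NumberField F] [IsCMField F]

theorem isPolarization_form {a : Fin (p + p) → F} (ha : ∀ j, cmConj F (a j) = - a j)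
    (hint : ∀ j, IsIntegral ℤ (a j)) (hneg : ∀ (τ : F →+* ℂ) k, (τ (a (D.enum τ k))).im < 0) :
    IsPolarization D.action.{u} (D.form a) := by
  refine ⟨D.isRiemannForm_form ha hint hneg, fun b z w => ?_⟩
  have key (z w : TangentSpace.{u} F p) :
      D.form a (actionEnd b z) w = D.form a z (actionEnd (cmConj F b) w) := by
    rw [form_apply, form_apply]
    refine Finset.sum_congr rfl fun i _ => ?_
    rw [actionEnd_apply, actionEnd_apply, map_cmConj, map_mul, Complex.conj_conj]
    congr 2
    ring
  exact key z w

/-- The hermitian form on `H₁` with diagonal coefficients `c`. -/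
def hermitianForm (c : Fin (p + p) → F) : letI := homologyModule D.action.{u}
    (D.toVariety.{u}).Homology →ₗ[F] (D.toVariety.{u}).Homology →ₛₗ[cmConj F] F :=
  letI := homologyModule D.action.{u}
  LinearMap.mk₂'ₛₗ (RingHom.id F) (cmConj F)
    (fun x y => ∑ j, c j * D.homologyEquiv.symm x j * cmConj F (D.homologyEquiv.symm y j))
    (fun x x' y => by
      simp only [map_add, Pi.add_apply, mul_add, add_mul, Finset.sum_add_distrib])
    (fun b x y => by
      rw [RingHom.id_apply, smul_eq_mul, Finset.mul_sum]
      refine Finset.sum_congr rfl fun j _ => ?_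
      rw [map_smul, Pi.smul_apply, smul_eq_mul]
      ring)
    (fun x y y' => by
      simp only [map_add, Pi.add_apply, mul_add, Finset.sum_add_distrib])
    (fun b x y => by
      rw [smul_eq_mul, Finset.mul_sum]
      refine Finset.sum_congr rfl fun j _ => ?_
      rw [map_smul, Pi.smul_apply, smul_eq_mul, map_mul]
      ring)

theorem hermitianForm_apply (c : Fin (p + p) → F) (x y : (D.toVariety.{u}).Homology) :
    let := homologyModule D.action.{u}
    D.hermitianForm c x y =
      ∑ j, c j * D.homologyEquiv.symm x j * cmConj F (D.homologyEquiv.symm y j) := rfl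

theorem isSplitWeilType_action : IsSplitWeilType D.action.{u} := by
  let := homologyModule D.action.{u}
  obtain ⟨f, c, hf0, hf, ⟨-, hc, W, hW, hiso⟩, hint, hneg⟩ := D.exists_coefficients
  refine ⟨D.isWeilType_action, D.form fun j => f * c j, f, D.hermitianForm c,
    W.map D.homologyEquiv.toLinearMap, D.isPolarization_form (fun j => ?_) hint hneg, hf0, hf,
    fun x y => ?_, fun x y => ?_, ?_, ?_⟩
  · rw [map_mul, hf, hc, neg_mul]
  · rw [hermitianForm_apply, hermitianForm_apply, map_sum]
    refine Finset.sum_congr rfl fun j _ => ?_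
    rw [map_mul, map_mul, hc, cmConj_cmConj]
    ring
  · obtain ⟨x, rfl⟩ := D.homologyEquiv.surjective x
    obtain ⟨y, rfl⟩ := D.homologyEquiv.surjective y
    refine (D.form_embed (fun j => f * c j) x y).trans ?_
    rw [hermitianForm_apply, Finset.mul_sum]
    simp only [LinearEquiv.symm_apply_apply, mul_assoc]
  · rintro _ ⟨x, hx, rfl⟩ _ ⟨y, hy, rfl⟩
    rw [hermitianForm_apply]
    simpa using hiso x hx y hy
  · rw [weilDegree_action, LinearEquiv.finrank_map_eq, hW, Fintype.card_fin]

/-- In the coordinates of `F^{2p}`, a top-degree alternating form over `F` is a multiple of the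
determinant. -/
theorem exists_isWeilClass (a : F) :
    ∃ w : (D.toVariety.{u}).Cohomology ℚ (p + p), IsWeilClass D.action w ∧
      ∀ x : Fin (p + p) → Fin (p + p) → F,
        letI := homologyModule D.action.{u}
        w (fun i => D.homologyEquiv (x i)) = Algebra.trace ℚ F (a * Matrix.det (Matrix.of x)) := by
  let := homologyModule D.action.{u}
  let η : (D.toVariety.{u}).Homology [⋀^Fin (p + p)]→ₗ[F] F :=
    (a • Matrix.detRowAlternating).compLinearMap D.homologyEquiv.symm.toLinearMap
  let ηℚ : (D.toVariety.{u}).Homology [⋀^Fin (p + p)]→ₗ[ℚ] F :=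
    { η.toMultilinearMap.restrictScalars ℚ with
      map_eq_zero_of_eq' := η.map_eq_zero_of_eq' }
  refine ⟨(Algebra.trace ℚ F).compAlternatingMap ηℚ,
    ⟨D.weilDegree_action, η, fun v => rfl⟩, fun x => ?_⟩
  have : η (fun i => D.homologyEquiv (x i)) = a * Matrix.det (Matrix.of x) := by
    simp only [η, AlternatingMap.compLinearMap_apply]
    have e : (fun i => D.homologyEquiv.symm.toLinearMap (D.homologyEquiv (x i))) = x :=
      funext fun i => D.homologyEquiv.symm_apply_apply (x i)
    rw [e]
    rfl
  rw [← this]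
  rfl

/-- Homomorphisms to the abelian variety attached to `D` from compatible `F`-valued classes. -/
theorem exists_hom (A : ComplexAbelianVariety.{u}) (s : Fin (p + p) → A.Cohomology1 F)
    (hint : ∀ j (x : A.V) (hx : x ∈ A.lattice), IsIntegral ℤ (s j ⟨x, Submodule.subset_span hx⟩))
    (hodge : ∀ (τ : F →+* ℂ) k,
      τ.toAddMonoidHom.toRatLinearMap ∘ₗ s (D.enum τ k) ∈ A.hodge10) :
    ∃ f : Hom A D.toVariety.{u},
      ∀ x, letI := homologyModule D.action.{u}
        f.homologyMap x = D.homologyEquiv fun j => s j x := by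
  choose l hl using hodge
  let L : A.V →ₗ[ℂ] TangentSpace.{u} F p := LinearMap.pi fun i => l i.down.1 i.down.2
  have hL (x : A.Homology) : L x = D.embed fun j => s j x := by
    funext i
    exact (hl i.down.1 i.down.2 x).symm
  have hLat : ∀ x ∈ A.lattice, L x ∈ D.lattice := fun x hx => by
    rw [hL ⟨x, Submodule.subset_span hx⟩]
    exact D.embed_mem_lattice fun j => hint j x hx
  exact ⟨⟨L, hLat⟩, fun x => Subtype.ext (hL x)⟩

end WeilCMType
end ComplexAbelianVariety
end

/-! ### A Galois CM-field containing given CM-fields -/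

noncomputable section

namespace NumberField

open Polynomial

theorem conj_eq_neg_of_sq_eq_neg_one {z : ℂ} (hz : z ^ 2 = -1) : starRingEnd ℂ z = -z := by
  have : (z - Complex.I) * (z + Complex.I) = 0 := by
    linear_combination hz - Complex.I_sq
  rcases mul_eq_zero.mp this with h | h
  · rw [sub_eq_zero.mp h, Complex.conj_I]
  · rw [eq_neg_of_add_eq_zero_left h, map_neg, Complex.conj_I]

/-- Finitely many CM-fields are contained in a Galois CM-field that contains all their
conjugates. -/
theorem exists_isCMField_isGalois {n : ℕ} (K : Fin n → Type) [∀ i, Field (K i)]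
    [∀ i, NumberField (K i)] [∀ i, IsCMField (K i)] :
    ∃ (F : IntermediateField ℚ ℂ) (_ : NumberField F), IsCMField F ∧ IsGalois ℚ F ∧
      ∀ i (σ : K i →+* ℂ) x, σ x ∈ F := by
  choose α hα using fun i => Field.exists_primitive_element ℚ (K i)
  -- Adjoining `Complex.I` as well makes the splitting field totally complex at no cost, even when
  -- `n = 0`.
  let P : ℚ[X] := (X ^ 2 + 1) * ∏ i, minpoly ℚ (α i)
  have hI0 : (X ^ 2 + 1 : ℚ[X]) ≠ 0 := (monic_X_pow_add_C (1 : ℚ) two_ne_zero).ne_zero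
  have hP : P ≠ 0 := mul_ne_zero hI0 <|
    Finset.prod_ne_zero_iff.mpr fun i _ => minpoly.ne_zero (Algebra.IsIntegral.isIntegral _)
  let F : IntermediateField ℚ ℂ := IntermediateField.adjoin ℚ (P.rootSet ℂ)
  have hsplit : IsSplittingField ℚ F P :=
    IntermediateField.adjoin_rootSet_isSplittingField (IsAlgClosed.splits _)
  have hfin : FiniteDimensional ℚ F := IsSplittingField.finiteDimensional F P
  have hnormal : Normal ℚ F := Normal.of_isSplittingField P
  have hnf : NumberField F := ⟨⟩
  have hgal : IsGalois ℚ F := ⟨⟩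
  have hroot (z : ℂ) : z ∈ P.rootSet ℂ ↔ z ^ 2 = -1 ∨ ∃ i, ∃ σ : K i →+* ℂ, σ (α i) = z := by
    rw [mem_rootSet_of_ne hP]
    simp only [P, map_mul, mul_eq_zero, map_prod, Finset.prod_eq_zero_iff, Finset.mem_univ,
      true_and]
    refine or_congr ?_ (exists_congr fun i => ?_)
    · simp only [map_add, map_pow, aeval_X, map_one]
      exact eq_neg_iff_add_eq_zero.symm
    · have h1 : z ∈ (minpoly ℚ (α i)).rootSet ℂ ↔ aeval z (minpoly ℚ (α i)) = 0 :=
        mem_rootSet_of_ne (minpoly.ne_zero (Algebra.IsIntegral.isIntegral _))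
      rw [← h1, ← Algebra.IsAlgebraic.range_eval_eq_rootSet_minpoly (F := ℚ) (K := K i) ℂ (α i)]
      exact ⟨fun ⟨σ, h⟩ => ⟨σ.toRingHom, h⟩, fun ⟨σ, h⟩ => ⟨σ.toRatAlgHom, h⟩⟩
  have hmem (i) (σ : K i →+* ℂ) (x : K i) : σ x ∈ F := by
    have h1 : (⊤ : IntermediateField ℚ (K i)).map σ.toRatAlgHom ≤ F := by
      rw [← hα i, IntermediateField.adjoin_map, IntermediateField.adjoin_le_iff]
      rintro _ ⟨_, rfl, rfl⟩
      exact IntermediateField.subset_adjoin _ _ ((hroot _).mpr (Or.inr ⟨i, σ, rfl⟩))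
    exact h1 ⟨x, trivial, rfl⟩
  have hImem : Complex.I ∈ F :=
    IntermediateField.subset_adjoin _ _ ((hroot _).mpr (Or.inl Complex.I_sq))
  have hcpx : IsTotallyComplex F := ⟨fun w => by
    rw [← InfinitePlace.not_isReal_iff_isComplex]
    intro hw
    rw [InfinitePlace.isReal_iff] at hw
    have h1 : w.embedding ⟨Complex.I, hImem⟩ ^ 2 = -1 := by
      rw [← map_pow, show (⟨Complex.I, hImem⟩ : F) ^ 2 = -1 from Subtype.ext Complex.I_sq, map_neg,
        map_one]
    have h2 := conj_eq_neg_of_sq_eq_neg_one h1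
    have h3 := RingHom.congr_fun hw ⟨Complex.I, hImem⟩
    rw [ComplexEmbedding.conjugate_coe_eq, h2] at h3
    have h4 : w.embedding ⟨Complex.I, hImem⟩ = 0 := by linear_combination (-1 / 2 : ℂ) * h3
    rw [h4] at h1
    norm_num at h1⟩
  let σ : Gal(F/ℚ) := (Complex.conjAe.restrictScalars ℚ).restrictNormal F
  have hσ (x : F) : ((σ x : F) : ℂ) = starRingEnd ℂ x :=
    AlgEquiv.restrictNormal_commutes (Complex.conjAe.restrictScalars ℚ) F x
  refine ⟨F, hnf, IsCMField.of_forall_isConj F (σ := σ) fun φ => ?_, hgal, hmem⟩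
  -- That conjugation commutes with every embedding need only be checked on generators: on square
  -- roots of -1 it is negation, and on conjugates of `α i` it is induced by the complex conjugation
  -- of `K i`.
  have key : (ComplexEmbedding.conjugate φ).toRatAlgHom =
      (φ.comp (σ : F →+* F)).toRatAlgHom := by
    refine IntermediateField.algHom_ext_of_eq_adjoin ℚ (S := F) rfl fun z hz => ?_
    change starRingEnd ℂ (φ ⟨z, _⟩) = φ (σ ⟨z, _⟩)
    rcases (hroot z).mp hz with h | ⟨i, τ, rfl⟩
    · have h1 : σ ⟨z, IntermediateField.subset_adjoin _ _ hz⟩ =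
          -⟨z, IntermediateField.subset_adjoin _ _ hz⟩ :=
        Subtype.ext ((hσ _).trans (conj_eq_neg_of_sq_eq_neg_one h))
      rw [h1, map_neg]
      refine conj_eq_neg_of_sq_eq_neg_one ?_
      rw [← map_pow, show (⟨z, IntermediateField.subset_adjoin _ _ hz⟩ : F) ^ 2 = -1 from
        Subtype.ext h, map_neg, map_one]
    · let τ' : K i →+* F := τ.codRestrict F (hmem i τ)
      have h1 : σ (τ' (α i)) = τ' (IsCMField.complexConj (K i) (α i)) :=
        Subtype.ext ((hσ _).trans (IsCMField.complexEmbedding_complexConj (K i) τ (α i)).symm)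
      have h2 := IsCMField.complexEmbedding_complexConj (K i) (φ.comp τ') (α i)
      exact h2.symm.trans (congrArg φ h1.symm)
  exact RingHom.ext fun x => AlgHom.congr_fun key x

end NumberField
end

/-! ### Eigenvectors of the CM action -/

noncomputable section

namespace ComplexAbelianVariety

open NumberField

/-- The image in `H¹(A, ℂ)` of a class in `H¹(A, F)` under a complex embedding of `F`. -/
def complexify {A : ComplexAbelianVariety.{u}} {F : Type*} [Field F] [CharZero F] (τ : F →+* ℂ)
    (ω : A.Cohomology1 F) : A.Cohomology1 ℂ :=
  τ.toAddMonoidHom.toRatLinearMap ∘ₗ ω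

/-- A basis of `H¹(A, F)` adapted to the Hodge decomposition at every complex embedding of `F`,
integral on the lattice, together with a dual basis. -/
structure HodgeFrame (A : ComplexAbelianVariety.{u}) (F : Type) [Field F] [CharZero F]
    (S : Type) [Fintype S] [DecidableEq S] where
  form : S → A.Cohomology1 F
  isIntegral : ∀ s (x : A.V) (hx : x ∈ A.lattice),
    IsIntegral ℤ (form s ⟨x, Submodule.subset_span hx⟩)
  basis : Module.Basis S ℚ A.Homology
  dual : S → S → F
  sum_dual_mul_form : ∀ s s', ∑ j, dual s j * form s' (basis j) = if s' = s then 1 else 0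
  sum_form_mul_dual : ∀ i j, ∑ s, form s (basis i) * dual s j = if j = i then 1 else 0
  hodge : ∀ (τ : F →+* ℂ) s,
    complexify τ (form s) ∈ A.hodge10 ∨ complexify τ (form s) ∈ A.hodge01

section CM

variable {A : ComplexAbelianVariety.{u}}

theorem eq_zero_of_homologyEnd_eq_zero {φ : A.End0} (h : A.homologyEnd φ = 0) : φ = 0 := by
  refine Subtype.ext (LinearMap.ext fun v => ?_)
  have : (φ : Module.End ℂ A.V).restrictScalars ℝ = 0 :=
    realLinearMap_ext fun x => congrArg Subtype.val (LinearMap.congr_fun h x)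
  exact LinearMap.congr_fun this v

/-- With the injectivity of the orbit map of a faithful vector, this bound makes homology, and not
only cohomology, cyclic under the CM-algebra. -/
theorem finrank_homology_le {E : Type} [CommRing E] (ν : E →+* A.End0) {R : Type*} [CommRing R]
    [Algebra ℚ R] [Module.Finite ℚ R] (e : R ≃+* E)
    (h : letI := cohomology1Module ν ℚ
      Module.Free E (A.Cohomology1 ℚ) ∧ Module.finrank E (A.Cohomology1 ℚ) = 1) :
    Module.finrank ℚ A.Homology ≤ Module.finrank ℚ R := by
  let := cohomology1Module ν ℚ
  obtain ⟨hfree, hrank⟩ := h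
  have h1 : Module.finrank ℚ (A.Cohomology1 ℚ) = Module.finrank ℚ A.Homology := by
    rw [Module.finrank_linearMap, Module.finrank_self, mul_one]
  rw [← h1]
  obtain ⟨ℓ, hℓ⟩ : ∃ ℓ : A.Cohomology1 ℚ, ∀ ω, ∃ a : E, a • ℓ = ω := by
    rcases subsingleton_or_nontrivial E with hE | hE
    · have := Module.subsingleton E (A.Cohomology1 ℚ)
      exact ⟨0, fun ω => ⟨0, Subsingleton.elim _ _⟩⟩
    · let b := Module.basisUnique Unit hrank
      refine ⟨b (), fun ω => ⟨b.repr ω (), ?_⟩⟩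
      simpa using b.sum_repr ω
  let f : R →+ A.Cohomology1 ℚ :=
    { toFun := fun r => e r • ℓ
      map_zero' := by rw [map_zero, zero_smul]
      map_add' := fun a b => by rw [map_add, add_smul] }
  refine LinearMap.finrank_le_finrank_of_surjective (f := f.toRatLinearMap) fun ω => ?_
  obtain ⟨a, ha⟩ := hℓ ω
  exact ⟨e.symm a, by
    change e (e.symm a) • ℓ = ω
    rw [e.apply_symm_apply, ha]⟩

variable {ι : Type} [Fintype ι] [DecidableEq ι] {K : ι → Type} [∀ i, Field (K i)]

/-- A faithful action of a finite product of fields has a vector with trivial annihilator. -/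
theorem exists_faithful_vector (μ : (∀ i, K i) →+* A.End0) (hμ : Function.Injective μ) :
    ∃ x : A.Homology, ∀ r, A.homologyEnd (μ r) x = 0 → r = 0 := by
  let := homologyModule μ
  have h1 (i) : ∃ y : A.Homology, (Pi.single i 1 : ∀ i, K i) • y ≠ 0 := by
    by_contra! h
    have h2 : μ (Pi.single i 1) = 0 := eq_zero_of_homologyEnd_eq_zero (LinearMap.ext h)
    rw [← map_zero μ] at h2
    have := congrFun (hμ h2) i
    simp at this
  choose y hy using h1
  -- If `r i ≠ 0`, multiplying `r • x = 0` by the inverse of `r i` placed at `i` isolates the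
  -- nonzero summand of index `i`.
  refine ⟨∑ i, (Pi.single i 1 : ∀ i, K i) • y i, fun r hr => ?_⟩
  change r • (∑ i, (Pi.single i 1 : ∀ i, K i) • y i) = 0 at hr
  funext i
  by_contra hi
  rw [Pi.zero_apply] at hi
  apply hy i
  have h2 := congrArg ((Pi.single i (r i)⁻¹ : ∀ i, K i) • ·) hr
  simp only [smul_zero, Finset.smul_sum, smul_smul] at h2
  rw [Finset.sum_eq_single i] at h2
  · rw [← h2]
    congr 1
    funext j
    by_cases hj : j = i
    · subst hj
      simp [hi]
    · simp [hj]
  · intro j _ hj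
    have : (Pi.single i (r i)⁻¹ * (r * Pi.single j 1) : ∀ i, K i) = 0 := by
      funext k
      by_cases hk : k = i
      · subst hk
        simp [Ne.symm hj]
      · simp [hk]
    rw [this, zero_smul]
  · simp

/-- A class that is an eigenvector for a cyclic action is of pure Hodge type. -/
theorem mem_hodge_of_eigenvector {R : Type*} [CommRing R] (μ : R →+* A.End0) {x : A.Homology}
    (hx : ∀ y, ∃ r, A.homologyEnd (μ r) x = y) (χ : R → ℂ) {ω : A.Cohomology1 ℂ}
    (hω : ∀ r y, ω (A.homologyEnd (μ r) y) = χ r * ω y) :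
    ω ∈ A.hodge10 ∨ ω ∈ A.hodge01 := by
  obtain ⟨ω₁, h1, ω₂, h2, rfl⟩ := exists_add_hodge ω
  -- The action preserves both Hodge pieces and these are independent, so each component satisfies
  -- the eigenvector equation separately.
  have key (r y) : ω₁ (A.homologyEnd (μ r) y) = χ r * ω₁ y ∧
      ω₂ (A.homologyEnd (μ r) y) = χ r * ω₂ y := by
    have e1 : ω₁ ∘ₗ A.homologyEnd (μ r) - χ r • ω₁ ∈ A.hodge10 :=
      sub_mem (comp_homologyEnd_mem_hodge10 _ h1) (Submodule.smul_mem _ _ h1)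
    have e2 : ω₂ ∘ₗ A.homologyEnd (μ r) - χ r • ω₂ ∈ A.hodge01Submodule :=
      sub_mem (comp_homologyEnd_mem_hodge01 _ h2) (Submodule.smul_mem _ _ h2)
    have e3 : ω₁ ∘ₗ A.homologyEnd (μ r) - χ r • ω₁ =
        -(ω₂ ∘ₗ A.homologyEnd (μ r) - χ r • ω₂) := by
      refine LinearMap.ext fun y => ?_
      have := hω r y
      simp only [LinearMap.add_apply] at this
      simp only [LinearMap.sub_apply, LinearMap.comp_apply, LinearMap.smul_apply, smul_eq_mul,
        LinearMap.neg_apply]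
      linear_combination this
    have e4 := eq_zero_of_mem_hodge10_of_mem_hodge01 e1
      (by rw [e3]; exact neg_mem (S := Submodule ℂ (A.Cohomology1 ℂ)) e2)
    have e5 : ω₂ ∘ₗ A.homologyEnd (μ r) - χ r • ω₂ = 0 := by
      rw [e4] at e3
      exact neg_eq_zero.mp e3.symm
    exact ⟨sub_eq_zero.mp (LinearMap.congr_fun e4 y), sub_eq_zero.mp (LinearMap.congr_fun e5 y)⟩
  -- An eigenvector is determined by its value at the cyclic vector `x`, so the eigenspace is at
  -- most a line.
  have hlin (η η' : A.Cohomology1 ℂ) (h : ∀ r y, η (A.homologyEnd (μ r) y) = χ r * η y)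
      (h' : ∀ r y, η' (A.homologyEnd (μ r) y) = χ r * η' y) (h0 : η x ≠ 0) :
      η' = (η' x / η x) • η := by
    refine LinearMap.ext fun y => ?_
    obtain ⟨r, rfl⟩ := hx y
    rw [LinearMap.smul_apply, h, h', smul_eq_mul]
    field_simp
  by_cases h0 : ω₁ x = 0
  · right
    have h3 : ω₁ = 0 := LinearMap.ext fun y => by
      obtain ⟨r, rfl⟩ := hx y
      rw [(key r x).1, h0, mul_zero, LinearMap.zero_apply]
    rwa [h3, zero_add]
  · left
    rw [hlin ω₁ ω₂ (fun r y => (key r y).1) (fun r y => (key r y).2) h0]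
    exact add_mem h1 (Submodule.smul_mem _ _ h1)

end CM

end ComplexAbelianVariety
end

/-! ### Construction of the Hodge frame -/

noncomputable section

namespace ComplexAbelianVariety

open NumberField

variable {A : ComplexAbelianVariety.{u}}

/-- Linearly independent families of `F`-valued classes can be made integral on the lattice and
have a dual basis. -/
theorem nonempty_hodgeFrame {F : Type} [Field F] [NumberField F] {S : Type} [Fintype S]
    [DecidableEq S] (ω : S → A.Cohomology1 F)
    (hind : ∀ a : S → F, (∀ x, ∑ s, a s * ω s x = 0) → a = 0)
    (hcard : Fintype.card S = Module.finrank ℚ A.Homology)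
    (hodge : ∀ (τ : F →+* ℂ) s,
      complexify τ (ω s) ∈ A.hodge10 ∨ complexify τ (ω s) ∈ A.hodge01) :
    Nonempty (HodgeFrame A F S) := by
  obtain ⟨T, hT⟩ := ZLattice.FG ℝ A.lattice
  have hTmem (x : T) : (x : A.V) ∈ A.lattice := by
    rw [← hT]
    exact Submodule.subset_span x.2
  -- One common denominator, taken over lattice generators, makes all the forms integral; being a
  -- rational integer, it does not affect Hodge types.
  obtain ⟨N, hN0, hN⟩ := WeilCMType.exists_nat_mul_isIntegral
    fun i : S × T => ω i.1 ⟨i.2, Submodule.subset_span (hTmem i.2)⟩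
  let η : S → A.Cohomology1 F := fun s => (N : F) • ω s
  have hη (s x) : η s x = N * ω s x := rfl
  have hNF : (N : F) ≠ 0 := Nat.cast_ne_zero.mpr hN0
  let b : Module.Basis S ℚ A.Homology :=
    (Module.finBasisOfFinrankEq ℚ A.Homology hcard.symm).reindex (Fintype.equivFin S).symm
  let M : Matrix S S F := Matrix.of fun s j => η s (b j)
  have hM : IsUnit M := by
    rw [← Matrix.linearIndependent_rows_iff_isUnit, Fintype.linearIndependent_iff]
    intro a ha
    refine congrFun (hind a ?_)
    let L : A.Cohomology1 F := ∑ s, a s • ω s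
    have hL (x) : L x = ∑ s, a s * ω s x := by simp [L, LinearMap.sum_apply]
    have h0 : L = 0 := b.ext fun j => by
      have h1 := congrFun ha j
      simp only [M, Finset.sum_apply, Pi.smul_apply, Matrix.row, Matrix.of_apply, hη, smul_eq_mul,
        Pi.zero_apply] at h1
      have h2 : (N : F) * L (b j) = 0 := by
        rw [hL, ← h1, Finset.mul_sum]
        exact Finset.sum_congr rfl fun s _ => by ring
      exact (mul_eq_zero.mp h2).resolve_left hNF
    intro x
    rw [← hL, h0, LinearMap.zero_apply]
  have hdet : IsUnit M.det := (Matrix.isUnit_iff_isUnit_det M).mp hM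
  refine ⟨⟨η, fun s x hx => ?_, b, fun s j => M⁻¹ j s, fun s s' => ?_, fun i j => ?_,
    fun τ s => ?_⟩⟩
  · have hx' := hx
    rw [← hT] at hx'
    induction hx' using Submodule.span_induction with
    | mem x h => exact hN (s, ⟨x, h⟩)
    | zero =>
      have : η s ⟨0, Submodule.subset_span hx⟩ = 0 := map_zero (η s)
      rw [this]
      exact isIntegral_zero
    | add x y hx1 hy1 h1 h2 =>
      rw [hT] at hx1 hy1
      have : η s ⟨x + y, Submodule.subset_span hx⟩ =
          η s ⟨x, Submodule.subset_span hx1⟩ + η s ⟨y, Submodule.subset_span hy1⟩ :=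
        map_add (η s) ⟨x, Submodule.subset_span hx1⟩ ⟨y, Submodule.subset_span hy1⟩
      rw [this]
      exact (h1 hx1).add (h2 hy1)
    | smul a x hx1 h1 =>
      rw [hT] at hx1
      have : η s ⟨a • x, Submodule.subset_span hx⟩ = a • η s ⟨x, Submodule.subset_span hx1⟩ :=
        map_zsmul (η s) a ⟨x, Submodule.subset_span hx1⟩
      rw [this]
      exact (h1 hx1).smul a
  · have := congrFun (congrFun (Matrix.mul_nonsing_inv M hdet) s') s
    rw [Matrix.mul_apply, Matrix.one_apply] at this
    rw [← this]
    exact Finset.sum_congr rfl fun j _ => mul_comm _ _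
  · have := congrFun (congrFun (Matrix.nonsing_inv_mul M hdet) j) i
    rw [Matrix.mul_apply, Matrix.one_apply] at this
    rw [← this]
    exact Finset.sum_congr rfl fun s _ => mul_comm _ _
  · have h1 : complexify τ (η s) = (N : ℂ) • complexify τ (ω s) := by
      refine LinearMap.ext fun x => ?_
      change τ (N * ω s x) = N * τ (ω s x)
      rw [map_mul, map_natCast]
    rw [h1]
    exact (hodge τ s).imp (Submodule.smul_mem _ _) (Submodule.smul_mem A.hodge01Submodule _)

/-- Identify homology with the CM-algebra by a cyclic vector. The projections to the factors
followed by embeddings into `F` are then eigenforms, as many as the dimension of homology. -/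
theorem IsCMType.exists_hodgeFrame (hA : A.IsCMType) :
    ∃ (F : Type) (_ : Field F) (_ : NumberField F) (_ : IsCMField F) (S : Type) (_ : Fintype S)
      (_ : DecidableEq S), IsGalois ℚ F ∧ Nonempty (HodgeFrame A F S) := by
  classical
  obtain ⟨E, _, ν, ⟨n, K, _, _, hK, ⟨e⟩⟩, hν, hfree⟩ := hA
  obtain ⟨F, _, hCM, hgal, hmem⟩ := exists_isCMField_isGalois K
  let μ : (∀ i, K i) →+* A.End0 := ν.comp e.symm.toRingHom
  have hμ : Function.Injective μ := hν.comp e.symm.injective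
  obtain ⟨x, hx⟩ := exists_faithful_vector μ hμ
  have hle := finrank_homology_le ν e.symm hfree
  let := homologyModule μ
  let f : (∀ i, K i) →+ A.Homology :=
    { toFun := fun r => r • x
      map_zero' := zero_smul _ _
      map_add' := fun a b => add_smul a b x }
  have hf : Function.Injective f.toRatLinearMap :=
    (injective_iff_map_eq_zero f.toRatLinearMap).mpr hx
  have hrank : Module.finrank ℚ (∀ i, K i) = Module.finrank ℚ A.Homology :=
    le_antisymm (LinearMap.finrank_le_finrank_of_injective hf) hle
  let θ : (∀ i, K i) ≃ₗ[ℚ] A.Homology :=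
    LinearEquiv.ofInjectiveOfFinrankEq f.toRatLinearMap hf hrank
  have hθ (r) : θ r = r • x := rfl
  have hθsmul (r) (y : A.Homology) : θ.symm (r • y) = r * θ.symm y := by
    rw [LinearEquiv.symm_apply_eq, hθ, mul_smul, ← hθ, θ.apply_symm_apply]
  let S := Σ i, (K i →+* ℂ)
  let χ : S → (∀ i, K i) →+* F := fun s =>
    (s.2.comp (Pi.evalRingHom K s.1)).codRestrict F fun r => hmem s.1 s.2 (r s.1)
  have hχ (s r) : ((χ s r : F) : ℂ) = s.2 (r s.1) := rfl
  have hχinj : Function.Injective fun s => (χ s : (∀ i, K i) →* F) := by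
    rintro ⟨i, σ⟩ ⟨j, τ⟩ h
    have h1 (r : ∀ i, K i) : σ (r i) = τ (r j) := congrArg Subtype.val (DFunLike.congr_fun h r)
    by_cases hij : i = j
    · subst hij
      congr 1
      refine RingHom.ext fun a => ?_
      simpa using h1 (Pi.single i a)
    · have := h1 (Pi.single i 1)
      simp [Ne.symm hij] at this
  let ω : S → A.Cohomology1 F := fun s => (χ s).toAddMonoidHom.toRatLinearMap ∘ₗ θ.symm.toLinearMap
  have hω (s y) : ω s y = χ s (θ.symm y) := rfl
  refine ⟨F, inferInstance, inferInstance, hCM, S, inferInstance, inferInstance, hgal,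
    nonempty_hodgeFrame ω (fun a ha => ?_) ?_ fun τ s => ?_⟩
  · have h1 := (linearIndependent_monoidHom (∀ i, K i) F).comp _ hχinj
    rw [Fintype.linearIndependent_iff] at h1
    refine funext (h1 a (funext fun r => ?_))
    have h2 := ha (θ r)
    simp only [hω, θ.symm_apply_apply] at h2
    simpa [Finset.sum_apply] using h2
  · rw [← hrank, Module.finrank_pi_fintype, Fintype.card_sigma]
    exact Finset.sum_congr rfl fun i _ => Embeddings.card (K i) ℂ
  · refine mem_hodge_of_eigenvector μ (x := x) (fun y => ⟨θ.symm y, ?_⟩) (fun r => τ (χ s r))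
      fun r y => ?_
    · exact θ.apply_symm_apply y
    · change τ (χ s (θ.symm (r • y))) = τ (χ s r) * τ (χ s (θ.symm y))
      rw [hθsmul, map_mul, map_mul]

end ComplexAbelianVariety
end

/-! ### Expansion of a Hodge class in eigenforms -/

noncomputable section

namespace ComplexAbelianVariety

open NumberField

/-- A basis adapted to two independent subspaces: coordinates along one of them vanish on the
other. -/
theorem coord_eq_zero_of_mem {k M S : Type*} [Field k] [AddCommGroup M] [Module k M] [Fintype S]
    [DecidableEq S] {P Q : Submodule k M} (hPQ : ∀ x ∈ P, x ∈ Q → x = 0) {e : S → M}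
    {c : S → M →ₗ[k] k} (hc : ∀ s s', c s (e s') = if s' = s then 1 else 0)
    (he : ∀ x, x = ∑ s, c s x • e s) (hmem : ∀ s, e s ∈ P ∨ e s ∈ Q) {x : M} (hx : x ∈ P) {s : S}
    (hs : e s ∈ Q) : c s x = 0 := by
  classical
  by_cases hs' : e s ∈ P
  · have h1 := hc s s
    rw [hPQ _ hs' hs, map_zero, if_pos rfl] at h1
    exact absurd h1 zero_ne_one
  have h1 : ∑ s' ∈ Finset.univ.filter (fun s' => e s' ∉ P), c s' x • e s' =
      x - ∑ s' ∈ Finset.univ.filter (fun s' => e s' ∈ P), c s' x • e s' := by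
    rw [eq_sub_iff_add_eq', Finset.sum_filter_add_sum_filter_not]
    exact (he x).symm
  have h2 : ∑ s' ∈ Finset.univ.filter (fun s' => e s' ∉ P), c s' x • e s' = 0 := by
    refine hPQ _ ?_ (Submodule.sum_mem _ fun s' h => Submodule.smul_mem _ _
      ((hmem s').resolve_left (Finset.mem_filter.mp h).2))
    rw [h1]
    exact sub_mem hx (Submodule.sum_mem _ fun s' h => Submodule.smul_mem _ _
      (Finset.mem_filter.mp h).2)
  have h3 := congrArg (c s) h2
  rw [map_sum, map_zero, Finset.sum_eq_single s] at h3
  · rwa [map_smul, hc, if_pos rfl, smul_eq_mul, mul_one] at h3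
  · intro s' _ h
    rw [map_smul, hc, if_neg h, smul_zero]
  · intro h
    exact absurd (Finset.mem_filter.mpr ⟨Finset.mem_univ s, hs'⟩) h

namespace HodgeFrame

variable {A : ComplexAbelianVariety.{u}} {F : Type} [Field F] [CharZero F] {S : Type} [Fintype S]
  [DecidableEq S] (H : HodgeFrame A F S)

theorem sum_form_mul_dual_eq_repr (x : A.Homology) (j : S) :
    ∑ s, H.form s x * H.dual s j = algebraMap ℚ F (H.basis.repr x j) := by
  let L : A.Cohomology1 F := ∑ s, H.dual s j • H.form s
  let R : A.Cohomology1 F := Algebra.linearMap ℚ F ∘ₗ H.basis.coord j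
  have h : L = R := H.basis.ext fun i => by
    simp only [L, R, LinearMap.sum_apply, LinearMap.smul_apply, smul_eq_mul, LinearMap.comp_apply,
      Module.Basis.coord_apply, Module.Basis.repr_self, Finsupp.single_apply,
      Algebra.linearMap_apply]
    have h1 := H.sum_form_mul_dual i j
    simp only [mul_comm (H.dual _ j), h1, eq_comm (a := i)]
    split_ifs <;> simp
  have h1 : L x = ∑ s, H.form s x * H.dual s j := by
    simp [L, LinearMap.sum_apply, mul_comm]
  rw [← h1, h]
  rfl

/-- The coefficient of `t` along the product of the classes `form (g i)`. -/
def coeff {r : ℕ} (t : A.Cohomology ℚ r) (g : Fin r → S) : F :=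
  ∑ h : Fin r → S, (∏ i, H.dual (g i) (h i)) * algebraMap ℚ F (t fun i => H.basis (h i))

theorem eq_sum_coeff_mul_prod {r : ℕ} (t : A.Cohomology ℚ r) (x : Fin r → A.Homology) :
    algebraMap ℚ F (t x) = ∑ g, H.coeff t g * ∏ i, H.form (g i) (x i) := by
  have h1 : t x = ∑ h : Fin r → S, (∏ i, H.basis.repr (x i) (h i)) • t fun i => H.basis (h i) := by
    conv_lhs => rw [show x = fun i => ∑ j, H.basis.repr (x i) j • H.basis j from
      funext fun i => (H.basis.sum_repr (x i)).symm]
    rw [← AlternatingMap.coe_multilinearMap, MultilinearMap.map_sum]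
    exact Finset.sum_congr rfl fun h _ => MultilinearMap.map_smul_univ _ _ _
  simp only [coeff, Finset.sum_mul]
  rw [Finset.sum_comm, h1, map_sum]
  refine Finset.sum_congr rfl fun h _ => ?_
  rw [smul_eq_mul, map_mul, map_prod]
  simp only [← H.sum_form_mul_dual_eq_repr]
  rw [Finset.prod_univ_sum, Fintype.piFinset_univ, Finset.sum_mul]
  refine Finset.sum_congr rfl fun g _ => ?_
  rw [Finset.prod_mul_distrib]
  ring

/-- Summing the expansion over all permutations of the arguments, with signs, turns products of
forms into determinants, the shape in which Weil classes pull back. -/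
theorem factorial_mul_eq_sum_coeff_mul_det {r : ℕ} (t : A.Cohomology ℚ r)
    (x : Fin r → A.Homology) :
    (r.factorial : F) * algebraMap ℚ F (t x) =
      ∑ g, H.coeff t g * Matrix.det (Matrix.of fun i j => H.form (g j) (x i)) := by
  have h1 (π : Equiv.Perm (Fin r)) : algebraMap ℚ F (t x) =
      ∑ g, H.coeff t g * (((Equiv.Perm.sign π : ℤ) : F) * ∏ i, H.form (g i) (x (π i))) := by
    have h2 : t x = ((Equiv.Perm.sign π : ℤ) : ℚ) * t (x ∘ π) := by
      rw [AlternatingMap.map_perm, Units.smul_def, zsmul_eq_mul, ← mul_assoc, ← Int.cast_mul,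
        ← Units.val_mul, Int.units_mul_self, Units.val_one, Int.cast_one, one_mul]
    rw [h2, map_mul, H.eq_sum_coeff_mul_prod, Finset.mul_sum]
    refine Finset.sum_congr rfl fun g _ => ?_
    simp only [map_intCast, Function.comp_apply]
    ring
  have h3 : (r.factorial : F) * algebraMap ℚ F (t x) =
      ∑ π : Equiv.Perm (Fin r), algebraMap ℚ F (t x) := by
    rw [Finset.sum_const, Finset.card_univ, Fintype.card_perm, Fintype.card_fin, nsmul_eq_mul]
  rw [h3, Finset.sum_congr rfl fun π _ => h1 π, Finset.sum_comm]
  refine Finset.sum_congr rfl fun g _ => ?_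
  rw [← Finset.mul_sum, Matrix.det_apply']
  rfl

/-- The coordinate of a class in `H¹(A, ℂ)` along `form s`. -/
def pairing (τ : F →+* ℂ) (s : S) : A.Cohomology1 ℂ →ₗ[ℂ] ℂ where
  toFun ω := ∑ j, τ (H.dual s j) * ω (H.basis j)
  map_add' ω η := by simp [mul_add, Finset.sum_add_distrib]
  map_smul' c ω := by simp [Finset.mul_sum, mul_left_comm]

theorem pairing_apply (τ : F →+* ℂ) (s : S) (ω : A.Cohomology1 ℂ) :
    H.pairing τ s ω = ∑ j, τ (H.dual s j) * ω (H.basis j) := rfl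

theorem complexify_apply (τ : F →+* ℂ) (ω : A.Cohomology1 F) (x) :
    complexify τ ω x = τ (ω x) := rfl

theorem pairing_complexify_form (τ : F →+* ℂ) (s s' : S) :
    H.pairing τ s (complexify τ (H.form s')) = if s' = s then 1 else 0 := by
  simp only [pairing_apply, complexify_apply, ← map_mul, ← map_sum, H.sum_dual_mul_form]
  split_ifs <;> simp

theorem eq_sum_pairing_smul (τ : F →+* ℂ) (ω : A.Cohomology1 ℂ) :
    ω = ∑ s, H.pairing τ s ω • complexify τ (H.form s) := by
  refine H.basis.ext fun i => ?_
  have h1 : ∑ j, (∑ s, τ (H.form s (H.basis i) * H.dual s j)) * ω (H.basis j) =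
      ω (H.basis i) := by
    simp only [← map_sum, H.sum_form_mul_dual]
    rw [Finset.sum_eq_single i]
    · simp
    · intro j _ hj
      simp [hj]
    · simp
  simp only [LinearMap.sum_apply, LinearMap.smul_apply, pairing_apply, complexify_apply,
    smul_eq_mul, Finset.sum_mul]
  rw [Finset.sum_comm, ← h1]
  refine Finset.sum_congr rfl fun j _ => ?_
  rw [Finset.sum_mul]
  refine Finset.sum_congr rfl fun s _ => ?_
  rw [map_mul]
  ring

theorem pairing_eq_zero_of_mem_hodge10 {τ : F →+* ℂ} {s : S} {ω : A.Cohomology1 ℂ}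
    (hω : ω ∈ A.hodge10) (hs : complexify τ (H.form s) ∈ A.hodge01) : H.pairing τ s ω = 0 :=
  coord_eq_zero_of_mem (P := A.hodge10) (Q := A.hodge01Submodule)
    (fun _ h h' => eq_zero_of_mem_hodge10_of_mem_hodge01 h h') (H.pairing_complexify_form τ)
    (H.eq_sum_pairing_smul τ) (H.hodge τ) hω hs

theorem pairing_eq_zero_of_mem_hodge01 {τ : F →+* ℂ} {s : S} {ω : A.Cohomology1 ℂ}
    (hω : ω ∈ A.hodge01) (hs : complexify τ (H.form s) ∈ A.hodge10) : H.pairing τ s ω = 0 :=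
  coord_eq_zero_of_mem (P := A.hodge01Submodule) (Q := A.hodge10)
    (fun _ h h' => eq_zero_of_mem_hodge10_of_mem_hodge01 h' h) (H.pairing_complexify_form τ)
    (H.eq_sum_pairing_smul τ) (fun s => (H.hodge τ s).symm) hω hs

/-- The indices `i` for which `form (g i)` is of type `(1, 0)` at `τ`. -/
def holomorphicIndices {r : ℕ} (g : Fin r → S) (τ : F →+* ℂ) : Finset (Fin r) :=
  letI := Classical.decPred fun i => complexify τ (H.form (g i)) ∈ A.hodge10
  Finset.univ.filter fun i => complexify τ (H.form (g i)) ∈ A.hodge10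

theorem mem_holomorphicIndices {r : ℕ} {g : Fin r → S} {τ : F →+* ℂ} {i : Fin r} :
    i ∈ H.holomorphicIndices g τ ↔ complexify τ (H.form (g i)) ∈ A.hodge10 := by
  simp [holomorphicIndices]

/-- The complex coefficient functional extending `coeff`. -/
def complexCoeff {r : ℕ} (τ : F →+* ℂ) (g : Fin r → S) : A.Cohomology ℂ r →ₗ[ℂ] ℂ where
  toFun η := ∑ h : Fin r → S, (∏ i, τ (H.dual (g i) (h i))) * η fun i => H.basis (h i)
  map_add' η η' := by simp [mul_add, Finset.sum_add_distrib]
  map_smul' c η := by simp [Finset.mul_sum, mul_left_comm]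

theorem map_coeff {r : ℕ} (τ : F →+* ℂ) (t : A.Cohomology ℚ r) (g : Fin r → S) :
    τ (H.coeff t g) =
      H.complexCoeff τ g ((Algebra.linearMap ℚ ℂ).compAlternatingMap t) := by
  rw [coeff, map_sum]
  refine Finset.sum_congr rfl fun h _ => ?_
  rw [map_mul, map_prod]
  simp

/-- The coefficient functional is a product of coordinate functionals, so on a wedge it gives the
determinant of the pairings, here in its Leibniz expansion. -/
theorem complexCoeff_wedge {r : ℕ} (τ : F →+* ℂ) (g : Fin r → S) (l : Fin r → A.Cohomology1 ℂ) :
    H.complexCoeff τ g (A.wedge l) =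
      ∑ π : Equiv.Perm (Fin r), ((Equiv.Perm.sign π : ℤ) : ℂ) *
        ∏ i, H.pairing τ (g i) (l (π i)) := by
  have h1 (h : Fin r → S) : A.wedge l (fun i => H.basis (h i)) =
      ∑ π : Equiv.Perm (Fin r), ((Equiv.Perm.sign π : ℤ) : ℂ) *
        ∏ i, l (π i) (H.basis (h i)) := by
    change Matrix.det (Matrix.of fun i j => l j (H.basis (h i))) = _
    rw [← Matrix.det_transpose, Matrix.det_apply']
    rfl
  change ∑ h : Fin r → S, (∏ i, τ (H.dual (g i) (h i))) * A.wedge l (fun i => H.basis (h i)) = _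
  simp only [h1, Finset.mul_sum]
  rw [Finset.sum_comm]
  refine Finset.sum_congr rfl fun π _ => ?_
  simp only [pairing_apply]
  rw [Finset.prod_univ_sum, Fintype.piFinset_univ, Finset.mul_sum]
  refine Finset.sum_congr rfl fun h _ => ?_
  rw [Finset.prod_mul_distrib]
  ring

/-- A coordinate along a (0,1) eigenform kills (1,0) classes, and conversely. A nonzero Leibniz term
on a wedge of `p` forms of each type therefore matches types, which forces `p` holomorphic indices.
Rationality of `t` makes this available at every τ. -/
theorem card_holomorphicIndices {p : ℕ} {t : A.Cohomology ℚ (p + p)} (ht : A.IsHodgeClass t)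
    {g : Fin (p + p) → S} (hg : H.coeff t g ≠ 0) (τ : F →+* ℂ) :
    (H.holomorphicIndices g τ).card = p := by
  by_contra hcard
  apply hg
  have h1 : A.hodgePiece p p ≤ LinearMap.ker (H.complexCoeff τ g) := by
    refine Submodule.span_le.mpr ?_
    rintro _ ⟨l, m, hl, hm, rfl⟩
    rw [SetLike.mem_coe, LinearMap.mem_ker, complexCoeff_wedge]
    refine Finset.sum_eq_zero fun π _ => ?_
    by_contra h0
    have h2 := Finset.prod_ne_zero_iff.mp (right_ne_zero_of_mul h0)
    apply hcard
    -- In a nonzero term, `i` is holomorphic exactly when `π i` lies in the first block of `p`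
    -- factors.
    have h3 : H.holomorphicIndices g τ =
        (Finset.univ.map (Fin.castAddEmb p : Fin p ↪ Fin (p + p))).map π.symm.toEmbedding := by
      ext i
      rw [mem_holomorphicIndices]
      obtain ⟨j, rfl⟩ := π.symm.surjective i
      have h4 := h2 (π.symm j) (Finset.mem_univ _)
      rw [π.apply_symm_apply] at h4
      induction j using Fin.addCases with
      | left k =>
        rw [Fin.append_left] at h4
        have h5 := (H.hodge τ (g (π.symm (Fin.castAdd p k)))).resolve_right fun h =>
          h4 (H.pairing_eq_zero_of_mem_hodge10 (hl k) h)
        simp [h5]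
      | right k =>
        rw [Fin.append_right] at h4
        have h5 : complexify τ (H.form (g (π.symm (Fin.natAdd p k)))) ∉ A.hodge10 := fun h =>
          h4 (H.pairing_eq_zero_of_mem_hodge01 (hm k) h)
        simp only [h5, Finset.mem_map, false_iff]
        rintro ⟨_, ⟨a, -, rfl⟩, h⟩
        have h6 : (a : ℕ) = p + k := congrArg Fin.val (π.symm.injective h)
        have := a.isLt
        omega
    rw [h3, Finset.card_map, Finset.card_map, Finset.card_univ, Fintype.card_fin]
  have h2 := LinearMap.mem_ker.mp (h1 ht)
  rw [← map_coeff] at h2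
  exact (map_eq_zero τ).mp h2

end HodgeFrame

end ComplexAbelianVariety
end

/-! ### From balanced tuples to Weil classes, and conclusion -/

noncomputable section

namespace ComplexAbelianVariety

open NumberField

namespace HodgeFrame

variable {A : ComplexAbelianVariety.{u}} {F : Type} [Field F] [NumberField F]
  {S : Type} [Fintype S] [DecidableEq S] (H : HodgeFrame A F S)

theorem complexify_form_ne_zero (τ : F →+* ℂ) (s : S) : complexify τ (H.form s) ≠ 0 := by
  intro h
  have := H.pairing_complexify_form τ s s
  rw [h, map_zero, if_pos rfl] at this
  exact zero_ne_one this

theorem complexify_conjugate_mem_hodge10 (τ : F →+* ℂ) (s : S) :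
    complexify (ComplexEmbedding.conjugate τ) (H.form s) ∈ A.hodge10 ↔
      complexify τ (H.form s) ∉ A.hodge10 := by
  have h : complexify (ComplexEmbedding.conjugate τ) (H.form s) =
      conjCohomology1 (complexify τ (H.form s)) := rfl
  rw [h, conjCohomology1_mem_hodge10]
  exact ⟨fun h1 h2 => H.complexify_form_ne_zero τ s
    (eq_zero_of_mem_hodge10_of_mem_hodge01 h2 h1), (H.hodge τ s).resolve_left⟩

/-- The datum attached to a family of `2p` classes half of which are of type `(1, 0)` at every
complex embedding. -/
def weilCMType {p : ℕ} {g : Fin (p + p) → S}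
    (hg : ∀ τ, (H.holomorphicIndices g τ).card = p) : WeilCMType F p where
  enum τ k := (H.holomorphicIndices g τ).orderEmbOfFin (hg τ) k
  injective τ := ((H.holomorphicIndices g τ).orderEmbOfFin (hg τ)).injective
  mem_range_conjugate τ j := by
    rw [Finset.range_orderEmbOfFin, Finset.range_orderEmbOfFin, Finset.mem_coe, Finset.mem_coe,
      mem_holomorphicIndices, mem_holomorphicIndices]
    exact H.complexify_conjugate_mem_hodge10 τ (g j)

variable [IsCMField F]

/-- The map with components `H.form (g j)` is complex-linear because the complex structure of the
target was chosen to make the enumerated components holomorphic. -/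
theorem exists_hom_isWeilClass {p : ℕ} {g : Fin (p + p) → S}
    (hg : ∀ τ, (H.holomorphicIndices g τ).card = p) :
    ∃ f : Hom A (H.weilCMType hg).toVariety.{u}, ∀ a : F,
      ∃ w : (H.weilCMType hg).toVariety.{u}.Cohomology ℚ (p + p),
        IsWeilClass (H.weilCMType hg).action w ∧
        ∀ x, f.pullback w x = Algebra.trace ℚ F
          (a * Matrix.det (Matrix.of fun i j => H.form (g j) (x i))) := by
  obtain ⟨f, hf⟩ := (H.weilCMType hg).exists_hom A (fun j => H.form (g j))
    (fun j => H.isIntegral (g j)) fun τ k => by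
      have h : (H.weilCMType hg).enum τ k ∈ H.holomorphicIndices g τ :=
        Finset.orderEmbOfFin_mem _ _ _
      exact H.mem_holomorphicIndices.mp h
  refine ⟨f, fun a => ?_⟩
  obtain ⟨w, hw, h⟩ := (H.weilCMType hg).exists_isWeilClass.{u} a
  refine ⟨w, hw, fun x => ?_⟩
  exact (congrArg w (funext fun i => hf (x i))).trans (h fun i j => H.form (g j) (x i))

end HodgeFrame

/-- The trace of a rational number is `[F : ℚ]` times it; this accounts for the second factor in the
denominator, the factorial coming from antisymmetrization. -/
theorem HodgeFrame.eq_sum_trace {A : ComplexAbelianVariety.{u}} {F : Type} [Field F]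
    [NumberField F] {S : Type} [Fintype S] [DecidableEq S] (H : HodgeFrame A F S) {r : ℕ}
    (t : A.Cohomology ℚ r) (x : Fin r → A.Homology) :
    t x = ∑ g, Algebra.trace ℚ F (((r.factorial : F) * (Module.finrank ℚ F : F))⁻¹ *
      H.coeff t g * Matrix.det (Matrix.of fun i j => H.form (g j) (x i))) := by
  have h0 : (r.factorial : F) * (Module.finrank ℚ F : F) ≠ 0 :=
    mul_ne_zero (Nat.cast_ne_zero.mpr r.factorial_ne_zero)
      (Nat.cast_ne_zero.mpr Module.finrank_pos.ne')
  have h1 : algebraMap ℚ F ((Module.finrank ℚ F : ℚ)⁻¹ * t x) =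
      ∑ g, ((r.factorial : F) * (Module.finrank ℚ F : F))⁻¹ *
        H.coeff t g * Matrix.det (Matrix.of fun i j => H.form (g j) (x i)) := by
    simp only [mul_assoc]
    rw [← Finset.mul_sum, ← H.factorial_mul_eq_sum_coeff_mul_det, map_mul, map_inv₀, map_natCast]
    have := Nat.cast_ne_zero (R := F).mpr r.factorial_ne_zero
    field_simp
  rw [← map_sum, ← h1, Algebra.trace_algebraMap, nsmul_eq_mul, ← mul_assoc, mul_inv_cancel₀,
    one_mul]
  exact Nat.cast_ne_zero.mpr Module.finrank_pos.ne'

theorem cohomology_eq_zero_of_finrank_lt {A : ComplexAbelianVariety.{u}} {r : ℕ}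
    (h : Module.finrank ℚ A.Homology < r) (t : A.Cohomology ℚ r) : t = 0 := by
  refine AlternatingMap.ext fun x => t.map_linearDependent x fun hx => ?_
  have := hx.fintype_card_le_finrank
  rw [Fintype.card_fin] at this
  omega

/-- The decomposition of Hodge classes as sums of pull-backs of Weil classes, indexed by a finite
type. -/
theorem HodgeFrame.exists_family {A : ComplexAbelianVariety.{u}} {F : Type} [Field F]
    [NumberField F] [IsCMField F] {S : Type} [Fintype S] [DecidableEq S] (H : HodgeFrame A F S) :
    ∃ (I : Type) (_ : Fintype I) (B : I → ComplexAbelianVariety.{u}) (ν : ∀ i, F →+* (B i).End0)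
      (f : ∀ i, Hom A (B i)), (∀ i, IsSplitWeilType (ν i)) ∧
      ∀ (p : ℕ) (t : A.Cohomology ℚ (p + p)), A.IsHodgeClass t →
        ∃ (T : Finset I) (w : ∀ i, (B i).Cohomology ℚ (p + p)),
          (∀ i ∈ T, IsWeilClass (ν i) (w i)) ∧ t = ∑ i ∈ T, (f i).pullback (w i) := by
  classical
  -- Cohomology vanishes above the dimension of homology, so bounding `q` loses nothing and one
  -- finite family serves all `p`. Tuples with repetitions are kept; their determinants are zero.
  let I : Type := Σ q : Fin (Module.finrank ℚ A.Homology + 1),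
    {g : Fin (q.1 + q.1) → S // ∀ τ, (H.holomorphicIndices g τ).card = q.1}
  choose f hf using fun i : I => H.exists_hom_isWeilClass i.2.2
  refine ⟨I, inferInstance, _, fun i => (H.weilCMType i.2.2).action, f,
    fun i => (H.weilCMType i.2.2).isSplitWeilType_action, fun p t ht => ?_⟩
  by_cases hp : p < Module.finrank ℚ A.Homology + 1
  swap
  · refine ⟨∅, fun _ => 0, by simp, ?_⟩
    rw [Finset.sum_empty]
    exact cohomology_eq_zero_of_finrank_lt (by omega) t
  let c : F := ((p + p).factorial * (Module.finrank ℚ F : F))⁻¹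
  -- The family mixes all degrees while `w` must be given in degree `2p` for every index; indices of
  -- another degree receive the value 0 and are left out of the sum.
  have key (i : I) : ∃ w : ((H.weilCMType i.2.2).toVariety.{u}).Cohomology ℚ (p + p),
      ∀ h : i.1.1 = p, IsWeilClass (H.weilCMType i.2.2).action w ∧
        ∀ x, (f i).pullback w x = Algebra.trace ℚ F
          (c * H.coeff t (fun j => i.2.1 (Fin.cast (by rw [h]) j)) *
            Matrix.det (Matrix.of fun a b => H.form (i.2.1 (Fin.cast (by rw [h]) b)) (x a))) := by
    by_cases h : i.1.1 = p
    · subst h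
      obtain ⟨w, hw⟩ := hf i (c * H.coeff t i.2.1)
      exact ⟨w, fun _ => hw⟩
    · exact ⟨0, fun h' => absurd h' h⟩
  choose w hw using key
  let e : {g : Fin (p + p) → S // ∀ τ, (H.holomorphicIndices g τ).card = p} ↪ I :=
    Function.Embedding.sigmaMk
      (β := fun q : Fin (Module.finrank ℚ A.Homology + 1) =>
        {g : Fin (q.1 + q.1) → S // ∀ τ, (H.holomorphicIndices g τ).card = q.1}) ⟨p, hp⟩
  refine ⟨Finset.univ.map e, w, fun i hi => ?_, AlternatingMap.ext fun x => ?_⟩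
  · obtain ⟨g, -, rfl⟩ := Finset.mem_map.mp hi
    exact (hw (e g) rfl).1
  · let evalHom : A.Cohomology ℚ (p + p) →+ ℚ :=
      { toFun := fun t => t x
        map_zero' := rfl
        map_add' := fun _ _ => rfl }
    have heval (T : Finset I) (η : I → A.Cohomology ℚ (p + p)) :
        (∑ i ∈ T, η i) x = ∑ i ∈ T, η i x := map_sum evalHom η T
    rw [H.eq_sum_trace t x, heval, Finset.sum_map,
      Finset.sum_congr rfl fun g _ => (hw (e g) rfl).2 x]
    -- The trace formula sums over all tuples; the unbalanced ones drop out because their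
    -- coefficients vanish.
    rw [← Finset.sum_filter_of_ne (p := fun g => ∀ τ, (H.holomorphicIndices g τ).card = p)]
    · exact Finset.sum_subtype _ (fun g => by simp) _
    · intro g _ hg τ
      refine H.card_holomorphicIndices ht (fun h0 => hg ?_) τ
      rw [h0, mul_zero, zero_mul, map_zero]

end ComplexAbelianVariety
end

theorem theorem1 (A : ComplexAbelianVariety.{u}) (hA : A.IsCMType) :
    ∃ (F : Type) (_ : Field F) (_ : NumberField F) (_ : NumberField.IsCMField F)
      (n : ℕ) (B : Fin n → ComplexAbelianVariety.{u}) (ν : ∀ i, F →+* (B i).End0)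
      (f : ∀ i, ComplexAbelianVariety.Hom A (B i)),
      IsGalois ℚ F ∧
      (∀ i, ComplexAbelianVariety.IsSplitWeilType (ν i)) ∧
      ∀ (p : ℕ) (t : A.Cohomology ℚ (p + p)), A.IsHodgeClass t →
        ∃ (S : Finset (Fin n)) (w : ∀ i, (B i).Cohomology ℚ (p + p)),
          (∀ i ∈ S, ComplexAbelianVariety.IsWeilClass (ν i) (w i)) ∧
          t = ∑ i ∈ S, (f i).pullback (w i) := by
  obtain ⟨F, _, _, _, S, _, _, hgal, ⟨H⟩⟩ := hA.exists_hodgeFrame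
  obtain ⟨I, _, B, ν, f, hsplit, h⟩ := H.exists_family
  let e := (Fintype.equivFin I).symm
  refine ⟨F, inferInstance, inferInstance, inferInstance, Fintype.card I, fun i => B (e i),
    fun i => ν (e i), fun i => f (e i), hgal, fun i => hsplit (e i), fun p t ht => ?_⟩
  obtain ⟨T, w, hw, rfl⟩ := h p t ht
  refine ⟨T.map e.symm.toEmbedding, fun i => w (e i), fun i hi => hw (e i) ?_, ?_⟩
  · obtain ⟨j, hj, rfl⟩ := Finset.mem_map.mp hi
    simpa using hj
  · rw [Finset.sum_map T e.symm.toEmbedding fun i => (f (e i)).pullback (w (e i))]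
    refine Finset.sum_congr rfl fun j _ => ?_
    change (f j).pullback (w j) = (f (e (e.symm j))).pullback (w (e (e.symm j)))
    rw [e.apply_symm_apply]
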